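/- **Theorem.** Let $q$ be a prime power and let $t,k,n$ be integers with $1\le t<k$ and $n\ge 2k$. For an integer $m$ and an integer $j\ge 0$ put $${m\brack j}=\frac{(q^m-1)(q^{m-1}-1)\cdots(q^{m-j+1}-1)}{(q^j-1)(q^{j-1}-1)\cdots(q-1)},$$ ${m\brack j}=0$ for $j<0$, and $[m]={m\brack 1}$. A $q$-Steiner system with parameters $(t,k,n)$ is a set $\mathfrak B$ of $k$-dimensional subspaces of $\mathbb F_q^n$ such that every $t$-dimensional subspace of $\mathbb F_q^n$ is contained in exactly one element of $\mathfrak B$. Let $U$ be the $0/1$ matrix whose rows are indexed by the $k$-dimensional subspaces $X$ of $\mathbb F_q^n$ and whose columns are indexed by all the $q$-Steiner systems $\mathfrak B$ with parameters $(t,k,n)$, with $(X,\mathfrak B)$-entry $1$ if and only if $X\in\mathfrak B$. Let $\kappa$ be the number of these $q$-Steiner systems that contain a given $k$-dimensional subspace $X$ (it does not depend on $X$). For $0\le r\le k$ let $V_r$ be the $r$-th eigenspace of the Grassmann scheme, that is, the real vector space of all functions $f$ on the $k$-dimensional subspaces of the form $f(K)=\sum_{L\subseteq K,\ \dim L=r}g(L)$,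 where $g$ is a real function on the $r$-dimensional subspaces of $\mathbb F_q^n$ with $\sum_{L\supseteq M,\ \dim L=r}g(L)=0$ for every $(r-1)$-dimensional subspace $M$ (no condition on $g$ if $r=0$). Then the eigenvalues of $UU^{T}$ are exactly the numbers $$\mu_0=\kappa\left(1-\frac{[k-n]}{[k]}\sum_{i=0}^{t-1}q^{n-i}\,\frac{{n\brack i}}{{k-1\brack i}}\right)$$ and $$\mu_r=\kappa\left(1+(-1)^r q^{\binom r2-kr+k}\,\frac{1}{{n-k-1\brack r-1}}\sum_{i=0}^{t-1}(-1)^i q^{\binom i2}{k-i-1\brack r-i-1}{n-r\brack i}\right)\qquad(1\le r\le k).$$ More precisely, the space of all real functions on the $k$-dimensional subspaces is the direct sum of the nonzero spaces $V_0,V_1,\dots,V_k$, and $UU^{T}f=\mu_r f$ for all $f\in V_r$ and $0\le r\le k$. -/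

import Mathlib

/-- The Gaussian binomial coefficient `[n, k]_q` for an arbitrary integer `n`, equal to
`(q^n - 1)(q^(n-1) - 1)⋯(q^(n-k+1) - 1) / ((q^k - 1)(q^(k-1) - 1)⋯(q - 1))` for `k ≥ 0`
and to `0` for `k < 0`. -/
noncomputable def qBinom (q : ℝ) (n k : ℤ) : ℝ :=
  if k < 0 then 0
  else (∏ j ∈ Finset.range k.toNat, (q ^ (n - j) - 1)) /
    ∏ j ∈ Finset.range k.toNat, (q ^ (k - j) - 1)

/-- The `q`-analog integer `[n]_q = [n, 1]_q`. -/
noncomputable def qNum (q : ℝ) (n : ℤ) : ℝ := qBinom q n 1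

/-- The Grassmannian: the `k`-dimensional subspaces of `F ^ n`. -/
abbrev Gr (F : Type*) [Field F] (n k : ℕ) : Type _ :=
  {X : Submodule F (Fin n → F) // Module.finrank F X = k}

/-- The family `S_q(t, k, n)` of all `q`-Steiner systems: the sets of `k`-dimensional subspaces
(blocks) such that each `t`-dimensional subspace lies in exactly one block. -/
abbrev SteinerSystem (F : Type*) [Field F] (t k n : ℕ) : Type _ :=
  {B : Set (Gr F n k) // ∀ T : Gr F n t, ∃! X : Gr F n k, X ∈ B ∧ T.1 ≤ X.1}

noncomputable instance Gr.instFintype (F : Type*) [Field F] [Fintype F] (n k : ℕ) :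
    Fintype (Gr F n k) := Fintype.ofFinite _

noncomputable instance Gr.instDecidableEq (F : Type*) [Field F] (n k : ℕ) :
    DecidableEq (Gr F n k) := Classical.decEq _

noncomputable instance SteinerSystem.instFintype (F : Type*) [Field F] [Fintype F]
    (t k n : ℕ) : Fintype (SteinerSystem F t k n) := Fintype.ofFinite _

open Classical in
/-- The incidence matrix `U`: rows are indexed by the `k`-dimensional subspaces, columns by the
`q`-Steiner systems, and the `(X, B)`-entry is `1` if `X ∈ B` and `0` otherwise. -/
noncomputable def incidenceMatrix (F : Type*) [Field F] (t k n : ℕ) :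
    Matrix (Gr F n k) (SteinerSystem F t k n) ℝ :=
  Matrix.of fun X B => if X ∈ B.1 then 1 else 0

/-- The Gram matrix `U Uᵀ`. -/
noncomputable def gramMatrix (F : Type*) [Field F] [Fintype F] (t k n : ℕ) :
    Matrix (Gr F n k) (Gr F n k) ℝ :=
  incidenceMatrix F t k n * (incidenceMatrix F t k n).transpose

/-- The number `κ` of `q`-Steiner systems that have `X` as a block. -/
noncomputable def blockCount (F : Type*) [Field F] (t k n : ℕ) (X : Gr F n k) : ℕ :=
  Nat.card {B : SteinerSystem F t k n // X ∈ B.1}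

open Classical in
/-- The `r`-th eigenspace `V_r` of the Grassmann scheme: the span of the functions
`K ↦ ∑ g(L)`, the sum over the `r`-dimensional subspaces `L` of the `k`-dimensional subspace `K`,
where `g` is a function on the `r`-dimensional subspaces whose sum over those containing `M`
vanishes for every `(r - 1)`-dimensional subspace `M` (no condition if `r = 0`). -/
noncomputable def grassmannEigenspace (F : Type*) [Field F] [Fintype F] (n k r : ℕ) :
    Submodule ℝ (Gr F n k → ℝ) :=
  Submodule.span ℝ {f | ∃ g : Gr F n r → ℝ,
    (∀ M : Submodule F (Fin n → F), Module.finrank F M + 1 = r →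
      ∑ L : Gr F n r, (if M ≤ L.1 then g L else 0) = 0) ∧
    f = fun K => ∑ L : Gr F n r, if L.1 ≤ K.1 then g L else 0}

/-!
The Gram matrix `U Uᵀ` commutes with the general linear group, which acts transitively on the pairs
of `k`-dimensional subspaces with a given dimension of intersection
(`exists_linearEquiv_map_pair`). So its `(X, Y)`-entry depends only on `dim (X ⊓ Y)`. Two distinct
blocks of a Steiner system meet in dimension less than `t`; hence `U Uᵀ - κ` is a combination of the
`t` matrices `avoidMatrix F n k (k - i)`, `i < t`, where `avoidMatrix F n k s` counts the
`s`-dimensional subspaces of `X` that meet `Y` trivially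
(`exists_gramMatrix_eq_sum_avoidMatrix`).

These matrices are well suited to the eigenspaces: if the sums of `g` over the `r`-dimensional
subspaces through each given `(r - 1)`-dimensional one vanish, then Möbius inversion gives
`∑_{L ∩ S = 0} g L = (-1)^r q^(r choose 2) ∑_{L ≤ S} g L` (`IsNullFunction.sum_disjoint`). With the
count `card_between_disjoint` of subspaces this yields the eigenvalue of `avoidMatrix F n k s` on
`V_r`. It vanishes exactly for `s < r`, which makes the `V_r` independent; they span because every
function on `r`-dimensional subspaces is a null function plus one induced from dimension `r - 1`.

The coefficients of the combination need not be computed. Up to a nonzero factor depending only on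
`r`, the eigenvalue of `U Uᵀ - κ` on `V_r` is a polynomial of degree less than `t` in
`q^r + q^(n+1-r)`, and so is the claimed expression. Both take the value `-κ` for `1 ≤ r ≤ t`: on one
side the sum over the blocks of a Steiner system is proportional to the total sum of `g`, which is
zero, so `U Uᵀ` kills `V_r` (`gramMatrix_mulVec_eq_zero`); on the other side this is the
`q`-Vandermonde identity `sum_qBinom_mul_qBinom`. So the two polynomials agree
(`add_sum_avoidEigenvalue_eq`). On `V_0` the eigenvalue is `κ` times the number of blocks.
-/

/-! ### Gaussian binomial coefficients -/

theorem qBinom_natCast (q : ℝ) (N : ℤ) (d : ℕ) :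
    qBinom q N d = (∏ j ∈ Finset.range d, (q ^ (N - j) - 1)) /
      ∏ j ∈ Finset.range d, (q ^ ((d : ℤ) - j) - 1) := by
  simp [qBinom]

theorem qBinom_of_neg (q : ℝ) (N : ℤ) {j : ℤ} (hj : j < 0) : qBinom q N j = 0 := by
  simp [qBinom, hj]

theorem qBinom_zero (q : ℝ) (N : ℤ) : qBinom q N 0 = 1 := by
  simp [qBinom]

theorem zpow_sub_one_ne_zero {q : ℝ} (hq : 1 < q) {m : ℤ} (hm : m ≠ 0) : q ^ m - 1 ≠ 0 := by
  rw [sub_ne_zero]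
  intro h
  exact hm (by simpa using (zpow_right_injective₀ (by linarith) hq.ne') (h.trans (zpow_zero q).symm))

theorem qBinom_denom_ne_zero {q : ℝ} (hq : 1 < q) (d : ℕ) :
    ∏ j ∈ Finset.range d, (q ^ ((d : ℤ) - j) - 1) ≠ 0 := by
  refine Finset.prod_ne_zero_iff.2 fun j hj => zpow_sub_one_ne_zero hq ?_
  have := Finset.mem_range.1 hj
  omega

/-- Absorption: `[N, d+1] (q^(d+1) - 1) = (q^N - 1) [N-1, d]`. -/
theorem qBinom_succ_mul {q : ℝ} (hq : 1 < q) (N : ℤ) (d : ℕ) :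
    qBinom q N (d + 1 : ℕ) * (q ^ ((d : ℤ) + 1) - 1) = (q ^ N - 1) * qBinom q (N - 1) d := by
  have h1 := qBinom_denom_ne_zero hq d
  have h2 : q ^ ((d : ℤ) + 1) - 1 ≠ 0 := zpow_sub_one_ne_zero hq (by omega)
  rw [qBinom_natCast, qBinom_natCast, Finset.prod_range_succ', Finset.prod_range_succ']
  have e1 : ∏ j ∈ Finset.range d, (q ^ (N - ((j + 1 : ℕ) : ℤ)) - 1) =
      ∏ j ∈ Finset.range d, (q ^ (N - 1 - (j : ℤ)) - 1) :=
    Finset.prod_congr rfl fun j _ => by congr 2; push_cast; ring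
  have e2 : ∏ j ∈ Finset.range d, (q ^ (((d + 1 : ℕ) : ℤ) - ((j + 1 : ℕ) : ℤ)) - 1) =
      ∏ j ∈ Finset.range d, (q ^ ((d : ℤ) - (j : ℤ)) - 1) :=
    Finset.prod_congr rfl fun j _ => by congr 2; push_cast; ring
  rw [e1, e2]
  simp only [Nat.cast_zero, sub_zero, Nat.cast_add, Nat.cast_one]
  field_simp

/-- Lower-index recursion: `[N, d+1] (q^(d+1) - 1) = [N, d] (q^(N-d) - 1)`. -/
theorem qBinom_succ_mul' {q : ℝ} (hq : 1 < q) (N : ℤ) (d : ℕ) :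
    qBinom q N (d + 1 : ℕ) * (q ^ ((d : ℤ) + 1) - 1) = qBinom q N d * (q ^ (N - d) - 1) := by
  have h1 := qBinom_denom_ne_zero hq d
  have h2 : q ^ ((d : ℤ) + 1) - 1 ≠ 0 := zpow_sub_one_ne_zero hq (by omega)
  rw [qBinom_natCast, qBinom_natCast, Finset.prod_range_succ, Finset.prod_range_succ' _ d]
  have e2 : ∏ j ∈ Finset.range d, (q ^ (((d + 1 : ℕ) : ℤ) - ((j + 1 : ℕ) : ℤ)) - 1) =
      ∏ j ∈ Finset.range d, (q ^ ((d : ℤ) - (j : ℤ)) - 1) :=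
    Finset.prod_congr rfl fun j _ => by congr 2; push_cast; ring
  rw [e2]
  simp only [Nat.cast_zero, sub_zero, Nat.cast_add, Nat.cast_one]
  field_simp

theorem qBinom_pascal {q : ℝ} (hq : 1 < q) (N : ℤ) (d : ℕ) :
    qBinom q (N + 1) (d + 1 : ℕ) = qBinom q N (d + 1 : ℕ) + q ^ (N - d) * qBinom q N d := by
  have h2 : q ^ ((d : ℤ) + 1) - 1 ≠ 0 := zpow_sub_one_ne_zero hq (by omega)
  apply mul_right_cancel₀ h2
  have h3 := qBinom_succ_mul hq (N + 1) d
  rw [add_sub_cancel_right] at h3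
  have h4 := qBinom_succ_mul' hq N d
  have h5 : q ^ (N + 1) = q ^ (N - d) * q ^ ((d : ℤ) + 1) := by
    rw [← zpow_add₀ (by linarith)]; congr 1; ring
  rw [h3, add_mul, h4, h5]
  ring

theorem qBinom_pos {q : ℝ} (hq : 1 < q) {N : ℤ} {d : ℤ} (h0 : 0 ≤ d) (h : d ≤ N) :
    0 < qBinom q N d := by
  lift d to ℕ using h0
  have key : ∀ M : ℤ, (d : ℤ) ≤ M → 0 < ∏ j ∈ Finset.range d, (q ^ (M - j) - 1) := by
    intro M hM
    refine Finset.prod_pos fun j hj => sub_pos.2 (one_lt_zpow₀ hq ?_)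
    have := Finset.mem_range.1 hj
    omega
  rw [qBinom_natCast]
  exact div_pos (key N h) (key d le_rfl)

theorem qBinom_eq_zero {q : ℝ} {N : ℤ} {d : ℤ} (h0 : 0 ≤ N) (h : N < d) :
    qBinom q N d = 0 := by
  lift d to ℕ using (by omega)
  lift N to ℕ using h0
  rw [qBinom_natCast, Finset.prod_eq_zero (i := N), zero_div]
  · simpa using h
  · simp

theorem qBinom_self {q : ℝ} (hq : 1 < q) (d : ℕ) : qBinom q d d = 1 := by
  rw [qBinom_natCast, div_self (qBinom_denom_ne_zero hq d)]

/-- Reflection of the upper index: `[K, R] = (-1)^R q^(KR - R(R-1)/2) [R-K-1, R]`. -/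
theorem qBinom_reflect {q : ℝ} (hq : 1 < q) (K : ℤ) (R : ℕ) :
    qBinom q K R = (-1) ^ R * q ^ (K * R - R.choose 2) * qBinom q (R - K - 1) R := by
  have hq0 : q ≠ 0 := by linarith
  rw [qBinom_natCast, qBinom_natCast, mul_div_assoc']
  congr 1
  rw [← Finset.prod_range_reflect (fun j : ℕ => q ^ ((R : ℤ) - K - 1 - (j : ℤ)) - 1)]
  -- Factor by factor, `q^(K-j) - 1 = -q^(K-j) (q^(j-K) - 1)`.
  have h1 : ∀ R : ℕ, (-1 : ℝ) ^ R * q ^ (K * R - R.choose 2) =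
      ∏ j ∈ Finset.range R, (-q ^ (K - (j : ℤ))) := by
    intro R
    induction R with
    | zero => simp
    | succ R ih =>
      rw [Finset.prod_range_succ, ← ih, Nat.choose_succ_succ' R 1]
      have : K * ((R + 1 : ℕ) : ℤ) - ((R.choose 1 + R.choose (1 + 1) : ℕ) : ℤ) =
          (K * R - (R.choose 2 : ℕ)) + (K - R) := by
        push_cast; simp; ring
      rw [this, zpow_add₀ hq0]
      ring
  rw [h1, ← Finset.prod_mul_distrib]
  refine Finset.prod_congr rfl fun j hj => ?_
  have hj := Finset.mem_range.1 hj
  have : (R : ℤ) - K - 1 - ((R - 1 - j : ℕ) : ℤ) = -(K - j) := by omega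
  rw [this, neg_mul, mul_sub, ← zpow_add₀ hq0]
  simp

/-- A form of the `q`-Vandermonde identity, valid for every integer `K`. -/
theorem sum_qBinom_mul_qBinom {q : ℝ} (hq : 1 < q) (N : ℕ) : ∀ (K : ℤ) (R : ℕ),
    ∑ i ∈ Finset.range (R + 1), (-1 : ℝ) ^ i * q ^ (i.choose 2) *
      qBinom q (K - i) ((R : ℤ) - i) * qBinom q N i =
    (-1) ^ R * q ^ (K * R - R.choose 2) * qBinom q (N - K + R - 1) R := by
  have hq0 : q ≠ 0 := by linarith
  induction N with
  | zero =>
    intro K R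
    rw [Finset.sum_range_succ', Finset.sum_eq_zero, zero_add]
    · simp only [Nat.choose_zero_succ, pow_zero, Nat.cast_zero, sub_zero, qBinom_zero, mul_one,
        one_mul]
      rw [qBinom_reflect hq K R]
      congr 2
      ring
    · intro i _
      rw [qBinom_eq_zero (q := q) (N := ((0 : ℕ) : ℤ)) (by simp) (by push_cast; omega), mul_zero]
  | succ N ih =>
    intro K R
    cases R with
    | zero => simp [qBinom_zero]
    | succ R =>
      have ih1 := ih K (R + 1)
      have ih2 := ih (K - 1) R
      -- The `q`-Pascal rule on `[N+1, i]`, with `i` shifted in the second part.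
      have step : ∑ i ∈ Finset.range (R + 1 + 1), (-1 : ℝ) ^ i * q ^ (i.choose 2) *
            qBinom q (K - i) (((R + 1 : ℕ) : ℤ) - i) * qBinom q ((N + 1 : ℕ) : ℤ) i =
          ∑ i ∈ Finset.range (R + 1 + 1), (-1 : ℝ) ^ i * q ^ (i.choose 2) *
            qBinom q (K - i) (((R + 1 : ℕ) : ℤ) - i) * qBinom q N i -
          q ^ N * ∑ i ∈ Finset.range (R + 1), (-1 : ℝ) ^ i * q ^ (i.choose 2) *
            qBinom q (K - 1 - i) ((R : ℤ) - i) * qBinom q N i := by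
        rw [Finset.sum_range_succ' _ (R + 1), Finset.sum_range_succ' _ (R + 1), Finset.mul_sum,
          add_sub_right_comm, ← Finset.sum_sub_distrib]
        congr 1
        refine Finset.sum_congr rfl fun i _ => ?_
        rw [show ((N + 1 : ℕ) : ℤ) = (N : ℤ) + 1 by push_cast; rfl, qBinom_pascal hq]
        have e1 : K - ((i + 1 : ℕ) : ℤ) = K - 1 - i := by push_cast; ring
        have e2 : ((R + 1 : ℕ) : ℤ) - ((i + 1 : ℕ) : ℤ) = R - i := by push_cast; ring
        have e3 : (i + 1).choose 2 = i + i.choose 2 := by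
          rw [Nat.choose_succ_succ' i 1]; simp
        have e4 : q ^ N = q ^ i * q ^ ((N : ℤ) - i) := by
          rw [← zpow_natCast, ← zpow_natCast, ← zpow_add₀ hq0]; congr 1; ring
        rw [e1, e2, e3, e4, pow_add, pow_succ]
        ring
      rw [step, ih1, ih2]
      have e0 : (((N + 1 : ℕ) : ℤ) - K + ((R + 1 : ℕ) : ℤ) - 1) = (N - K + R) + 1 := by
        push_cast; ring
      have e1 : ((N : ℤ) - K + ((R + 1 : ℕ) : ℤ) - 1) = N - K + R := by push_cast; ring
      have e2 : ((N : ℤ) - (K - 1) + R - 1) = N - K + R := by ring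
      have e3 : (N : ℤ) - K + R - R = N - K := by ring
      rw [e0, e1, e2, qBinom_pascal hq, e3]
      have e4 : q ^ (K * ((R + 1 : ℕ) : ℤ) - ((R + 1).choose 2 : ℕ)) * q ^ ((N : ℤ) - K) =
          q ^ N * q ^ ((K - 1) * R - (R.choose 2 : ℕ)) := by
        rw [← zpow_natCast q N, ← zpow_add₀ hq0, ← zpow_add₀ hq0, Nat.choose_succ_succ' R 1]
        congr 1
        push_cast; simp; ring
      rw [pow_succ, mul_add]
      linear_combination ((-1) ^ R * qBinom q (N - K + R) R) * e4

/-- The alternating sum of Gaussian binomials that computes the Möbius function of a subspace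
lattice. -/
theorem alternating_sum_qBinom {q : ℝ} (hq : 1 < q) (w : ℕ) :
    ∑ i ∈ Finset.range (w + 1), (-1 : ℝ) ^ i * q ^ (i.choose 2) * qBinom q w i =
      if w = 0 then 1 else 0 := by
  have h := sum_qBinom_mul_qBinom hq w w w
  rcases Nat.eq_zero_or_pos w with rfl | hw
  · simp [qBinom_zero]
  · rw [if_neg hw.ne']
    rw [qBinom_eq_zero (N := (w : ℤ) - w + w - 1) (by omega) (by omega), mul_zero] at h
    rw [← h]
    refine Finset.sum_congr rfl fun i hi => ?_
    have hi := Finset.mem_range.1 hi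
    rw [show (w : ℤ) - i = ((w - i : ℕ) : ℤ) by omega, qBinom_self hq, mul_one]

/-- The `q`-factorial without its normalisation, `(q - 1)(q^2 - 1)⋯(q^m - 1)`. -/
noncomputable def qFact (q : ℝ) (m : ℕ) : ℝ := ∏ j ∈ Finset.range m, (q ^ (j + 1) - 1)

theorem qFact_pos {q : ℝ} (hq : 1 < q) (m : ℕ) : 0 < qFact q m :=
  Finset.prod_pos fun j _ => sub_pos.2 (one_lt_pow₀ hq (by omega))

theorem qFact_add (q : ℝ) (m i : ℕ) :
    qFact q (m + i) = qFact q m * ∏ l ∈ Finset.range i, (q ^ (m + 1 + l) - 1) := by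
  rw [qFact, Finset.prod_range_add, qFact]
  congr 1
  exact Finset.prod_congr rfl fun l _ => by congr 2; ring

/-- Removing the top `i` factors of a `q`-factorial. -/
theorem qFact_eq_sub_mul (q : ℝ) {m i : ℕ} (h : i ≤ m) :
    qFact q m = qFact q (m - i) * ∏ l ∈ Finset.range i, (q ^ ((m : ℤ) - l) - 1) := by
  obtain ⟨a, rfl⟩ := Nat.exists_eq_add_of_le' h
  rw [qFact_add, Nat.add_sub_cancel,
    ← Finset.prod_range_reflect (fun l : ℕ => q ^ (((a + i : ℕ) : ℤ) - l) - 1)]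
  congr 1
  refine Finset.prod_congr rfl fun l hl => ?_
  have := Finset.mem_range.1 hl
  rw [← zpow_natCast]
  congr 2
  omega

theorem qBinom_eq_qFact {q : ℝ} (hq : 1 < q) {a b : ℕ} (h : b ≤ a) :
    qBinom q a b = qFact q a / (qFact q b * qFact q (a - b)) := by
  rw [qBinom_natCast, qFact_eq_sub_mul q h, qFact_eq_sub_mul q (le_refl b), Nat.sub_self]
  have := qBinom_denom_ne_zero hq b
  have := (qFact_pos hq (a - b)).ne'
  simp only [qFact, Finset.range_zero, Finset.prod_empty, one_mul] at this ⊢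
  field_simp

/-! ### Counting subspaces that avoid a given subspace -/

open Module in
open Classical in
/-- The number of subspaces `Y` with `L ≤ Y ≤ X` and `dim Y = dim L + d` that meet `S` trivially.
The induction on `d` double counts the pairs `(Y, x)` with `x ∈ Y \ L`: such a `Y` is counted by the
same formula with `L + ⟨x⟩` in place of `L`, and `x` runs over the vectors of `X` outside `L + S`. -/
theorem card_between_disjoint {F V : Type*} [Field F] [Fintype F] [AddCommGroup V] [Module F V]
    [FiniteDimensional F V] (S X : Submodule F V) (hS : S ≤ X) (d : ℕ) :
    ∀ L : Submodule F V, L ≤ X → Disjoint L S →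
      (Nat.card {Y : Submodule F V // finrank F Y = finrank F L + d ∧
        L ≤ Y ∧ Y ≤ X ∧ Disjoint Y S} : ℝ) =
      (Fintype.card F : ℝ) ^ (finrank F S * d) *
        qBinom (Fintype.card F) ((finrank F X : ℤ) - finrank F L - finrank F S) d := by
  have hq : (1 : ℝ) < Fintype.card F := by exact_mod_cast Fintype.one_lt_card
  have hq0 : (Fintype.card F : ℝ) ≠ 0 := by linarith
  have : Finite V := Module.finite_of_finite F
  have : Fintype V := Fintype.ofFinite V
  have : Fintype (Submodule F V) := Fintype.ofFinite _
  induction d with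
  | zero =>
    intro L hL hLS
    have hu : Nat.card {Y : Submodule F V // finrank F Y = finrank F L + 0 ∧
        L ≤ Y ∧ Y ≤ X ∧ Disjoint Y S} = 1 := by
      rw [Nat.card_eq_one_iff_exists]
      refine ⟨⟨L, rfl, le_rfl, hL, hLS⟩, fun Y => Subtype.ext ?_⟩
      exact (Submodule.eq_of_le_of_finrank_eq Y.2.2.1 Y.2.1.symm).symm
    rw [hu]
    simp [qBinom_zero]
  | succ d ih =>
    intro L hL hLS
    set q : ℝ := (Fintype.card F : ℝ) with hqdef
    set N := Nat.card {Y : Submodule F V // finrank F Y = finrank F L + (d + 1) ∧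
        L ≤ Y ∧ Y ≤ X ∧ Disjoint Y S} with hN
    have cardW : ∀ W : Submodule F V, ((Finset.univ.filter (· ∈ W)).card : ℝ) =
        q ^ finrank F W := by
      intro W
      rw [hqdef, ← Fintype.card_subtype]
      exact_mod_cast Module.card_eq_pow_finrank (K := F) (V := W)
    have cardD : ∀ W W' : Submodule F V, W' ≤ W →
        ((Finset.univ.filter (fun x => x ∈ W ∧ x ∉ W')).card : ℝ) =
          q ^ finrank F W - q ^ finrank F W' := by
      intro W W' h
      rw [← cardW, ← cardW, eq_sub_iff_add_eq, ← Nat.cast_add, ← Finset.card_union_of_disjoint]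
      · congr 2
        ext x
        have := @h x
        simp only [Finset.mem_union, Finset.mem_filter, Finset.mem_univ, true_and]
        tauto
      · rw [Finset.disjoint_filter]
        tauto
    set T : Finset (Submodule F V) := Finset.univ.filter fun Y =>
      finrank F Y = finrank F L + (d + 1) ∧ L ≤ Y ∧ Y ≤ X ∧ Disjoint Y S with hT
    have hNT : N = T.card := by
      rw [hN, hT, Nat.card_eq_fintype_card, Fintype.card_subtype]
    set A : Finset V := Finset.univ.filter fun x => x ∈ X ∧ x ∉ L ⊔ S with hA
    have hsup : finrank F ↥(L ⊔ S) = finrank F L + finrank F S := by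
      have := Submodule.finrank_sup_add_finrank_inf_eq L S
      rwa [hLS.eq_bot, finrank_bot, add_zero] at this
    have dbl : ∑ Y ∈ T, ((Finset.univ.filter (fun x => x ∈ Y ∧ x ∉ L)).card : ℝ) =
        ∑ x ∈ A, ((T.filter fun Y => x ∈ Y).card : ℝ) := by
      have h := Finset.sum_card_bipartiteAbove_eq_sum_card_bipartiteBelow (s := T) (t := A)
        (fun Y x => x ∈ Y)
      simp only [Finset.bipartiteAbove, Finset.bipartiteBelow] at h
      have h' : ∀ Y ∈ T, (Finset.univ.filter (fun x => x ∈ Y ∧ x ∉ L)) =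
          A.filter fun x => x ∈ Y := by
        intro Y hY
        obtain ⟨h1, h2, h3, h4⟩ := (Finset.mem_filter.1 hY).2
        ext x
        simp only [hA, Finset.mem_filter, Finset.mem_univ, true_and]
        constructor
        · rintro ⟨hx, hxL⟩
          refine ⟨⟨h3 hx, fun hxs => hxL ?_⟩, hx⟩
          -- By the modular law, a vector of `Y` outside `L` is also outside `L ⊔ S`.
          have : (L ⊔ S) ⊓ Y = L := by
            rw [sup_inf_assoc_of_le _ h2, inf_comm, h4.eq_bot, sup_bot_eq]
          exact this ▸ ⟨hxs, hx⟩
        · rintro ⟨⟨_, hxs⟩, hx⟩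
          exact ⟨hx, fun hxL => hxs (Submodule.mem_sup_left hxL)⟩
      rw [Finset.sum_congr rfl fun Y hY => by rw [h' Y hY]]
      exact_mod_cast h
    have hl : ∀ Y ∈ T, ((Finset.univ.filter (fun x => x ∈ Y ∧ x ∉ L)).card : ℝ) =
        q ^ (finrank F L + (d + 1)) - q ^ finrank F L := by
      intro Y hY
      obtain ⟨h1, h2, h3, h4⟩ := (Finset.mem_filter.1 hY).2
      rw [cardD Y L h2, h1]
    have hr : ∀ x ∈ A, ((T.filter fun Y => x ∈ Y).card : ℝ) = q ^ (finrank F S * d) *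
        qBinom q ((finrank F X : ℤ) - finrank F L - finrank F S - 1) d := by
      intro x hx
      obtain ⟨hxX, hxs⟩ := (Finset.mem_filter.1 hx).2
      have hxL : x ∉ L := fun h => hxs (Submodule.mem_sup_left h)
      have hx0 : x ≠ 0 := fun h => hxL (h ▸ L.zero_mem)
      have hdim : finrank F ↥(L ⊔ F ∙ x) = finrank F L + 1 := by
        have h := Submodule.finrank_sup_add_finrank_inf_eq L (F ∙ x)
        rw [((Submodule.disjoint_span_singleton' hx0).2 hxL).eq_bot, finrank_bot,
          finrank_span_singleton hx0] at h
        simpa using h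
      have hdis : Disjoint (L ⊔ F ∙ x) S := by
        rw [sup_comm]
        refine hLS.disjoint_sup_left_of_disjoint_sup_right ?_
        exact ((Submodule.disjoint_span_singleton' hx0).2 hxs).symm
      have hle : L ⊔ F ∙ x ≤ X := sup_le hL ((Submodule.span_singleton_le_iff_mem _ _).2 hxX)
      have h := ih _ hle hdis
      rw [hdim] at h
      have e1 : (finrank F X : ℤ) - ((finrank F L + 1 : ℕ) : ℤ) - finrank F S =
        (finrank F X : ℤ) - finrank F L - finrank F S - 1 := by push_cast; ring
      rw [e1] at h
      rw [← h, Nat.card_eq_fintype_card, Fintype.card_subtype, hT, Finset.filter_filter]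
      congr 2
      ext Y
      simp only [Finset.mem_filter, Finset.mem_univ, true_and, sup_le_iff,
        Submodule.span_singleton_le_iff_mem]
      rw [show finrank F L + 1 + d = finrank F L + (d + 1) by ring]
      tauto
    rw [Finset.sum_congr rfl hl, Finset.sum_congr rfl hr, Finset.sum_const, Finset.sum_const,
      nsmul_eq_mul, nsmul_eq_mul, ← hNT, hA, cardD X (L ⊔ S) (sup_le hL hS), hsup] at dbl
    have hne : q ^ (finrank F L + (d + 1)) - q ^ finrank F L ≠ 0 := by
      rw [sub_ne_zero]
      exact (pow_lt_pow_right₀ hq (by omega)).ne'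
    apply mul_right_cancel₀ hne
    rw [dbl]
    have h3 := qBinom_succ_mul hq ((finrank F X : ℤ) - finrank F L - finrank F S) d
    have e2 : q ^ (finrank F L + (d + 1)) - q ^ finrank F L =
        q ^ finrank F L * (q ^ ((d : ℤ) + 1) - 1) := by
      rw [pow_add, show ((d : ℤ) + 1) = ((d + 1 : ℕ) : ℤ) by push_cast; rfl, zpow_natCast]; ring
    have e3 : q ^ finrank F X = q ^ finrank F L * q ^ finrank F S *
        q ^ ((finrank F X : ℤ) - finrank F L - finrank F S) := by
      rw [← zpow_natCast, ← zpow_natCast, ← zpow_natCast, ← zpow_add₀ hq0, ← zpow_add₀ hq0]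
      congr 1; ring
    rw [e2, e3, pow_add, mul_add, pow_add, mul_one]
    linear_combination (-(q ^ (finrank F S * d) * q ^ finrank F S * q ^ finrank F L)) * h3

/-! ### Null functions and the avoidance matrices -/

section

open Module

variable {F : Type*} [Field F] [Fintype F] {n r s k : ℕ}

open Classical in
/-- The sum of a function on the `r`-dimensional subspaces over those contained in `K`. -/
noncomputable def sumBelow (g : Gr F n r → ℝ) (K : Submodule F (Fin n → F)) : ℝ :=
  ∑ L : Gr F n r, if L.1 ≤ K then g L else 0

open Classical in
/-- The sum of a function on the `r`-dimensional subspaces over those containing `M`. -/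
noncomputable def sumAbove (g : Gr F n r → ℝ) (M : Submodule F (Fin n → F)) : ℝ :=
  ∑ L : Gr F n r, if M ≤ L.1 then g L else 0

/-- The functions on the `r`-dimensional subspaces whose sum over those containing any given
`(r - 1)`-dimensional subspace vanishes. -/
def IsNullFunction (g : Gr F n r → ℝ) : Prop :=
  ∀ M : Submodule F (Fin n → F), finrank F M + 1 = r → sumAbove g M = 0

theorem one_lt_card_real (F : Type*) [Field F] [Fintype F] : (1 : ℝ) < Fintype.card F := by
  exact_mod_cast Fintype.one_lt_card

open Classical in
theorem sum_gr_between_disjoint {L S X : Submodule F (Fin n → F)} (hS : S ≤ X) (hL : L ≤ X)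
    (hLS : Disjoint L S) :
    ∑ Y : Gr F n k, (if L ≤ Y.1 ∧ Y.1 ≤ X ∧ Disjoint Y.1 S then (1 : ℝ) else 0) =
      (Fintype.card F : ℝ) ^ ((finrank F S : ℤ) * (k - finrank F L)) *
        qBinom (Fintype.card F) ((finrank F X : ℤ) - finrank F L - finrank F S)
          ((k : ℤ) - finrank F L) := by
  rcases lt_or_ge k (finrank F L) with h | h
  · rw [qBinom_of_neg _ _ (by omega), mul_zero]
    refine Finset.sum_eq_zero fun Y _ => if_neg fun hY => ?_
    have := Submodule.finrank_mono hY.1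
    rw [Y.2] at this
    omega
  · obtain ⟨d, rfl⟩ := Nat.exists_eq_add_of_le h
    have h := card_between_disjoint S X hS d L hL hLS
    rw [Finset.sum_boole, ← Fintype.card_subtype]
    have e : ((finrank F L + d : ℕ) : ℤ) - finrank F L = d := by push_cast; ring
    rw [e, ← Nat.cast_mul, zpow_natCast, ← h, ← Nat.card_eq_fintype_card]
    exact congrArg _ (Nat.card_congr (Equiv.subtypeSubtypeEquivSubtypeInter
      (fun Y : Submodule F (Fin n → F) => finrank F Y = finrank F L + d)
      (fun Y => L ≤ Y ∧ Y ≤ X ∧ Disjoint Y S)))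

open Classical in
theorem sum_gr_between {L X : Submodule F (Fin n → F)} (hL : L ≤ X) :
    ∑ Y : Gr F n k, (if L ≤ Y.1 ∧ Y.1 ≤ X then (1 : ℝ) else 0) =
      qBinom (Fintype.card F) ((finrank F X : ℤ) - finrank F L) ((k : ℤ) - finrank F L) := by
  have h := sum_gr_between_disjoint (k := k) (bot_le : ⊥ ≤ X) hL disjoint_bot_right
  simpa using h

/-- Iterated summation over subspaces is a multiple of a single summation. -/
theorem sumBelow_sumBelow (g : Gr F n r → ℝ) (X : Submodule F (Fin n → F)) :
    sumBelow (fun S : Gr F n s => sumBelow g S.1) X =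
      qBinom (Fintype.card F) ((finrank F X : ℤ) - r) ((s : ℤ) - r) * sumBelow g X := by
  classical
  calc sumBelow (fun S : Gr F n s => sumBelow g S.1) X
      = ∑ S : Gr F n s, ∑ L : Gr F n r,
          g L * (if L.1 ≤ S.1 ∧ S.1 ≤ X then (1 : ℝ) else 0) := by
        refine Finset.sum_congr rfl fun S _ => ?_
        by_cases h : S.1 ≤ X <;> simp [h, sumBelow]
    _ = ∑ L : Gr F n r, g L * ∑ S : Gr F n s,
          (if L.1 ≤ S.1 ∧ S.1 ≤ X then (1 : ℝ) else 0) := by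
        rw [Finset.sum_comm]
        simp only [Finset.mul_sum]
    _ = _ := by
        rw [sumBelow, Finset.mul_sum]
        refine Finset.sum_congr rfl fun L _ => ?_
        by_cases h : L.1 ≤ X
        · rw [sum_gr_between h, L.2, if_pos h, mul_comm]
        · rw [if_neg h, Finset.sum_eq_zero, mul_zero, mul_zero]
          exact fun S _ => if_neg fun hS => h (hS.1.trans hS.2)

/-- Iterated summation over superspaces is a multiple of a single summation. -/
theorem sumAbove_sumAbove (g : Gr F n r → ℝ) (M : Submodule F (Fin n → F)) :
    sumAbove (fun S : Gr F n s => sumAbove g S.1) M =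
      qBinom (Fintype.card F) ((r : ℤ) - finrank F M) ((s : ℤ) - finrank F M) *
        sumAbove g M := by
  classical
  calc sumAbove (fun S : Gr F n s => sumAbove g S.1) M
      = ∑ S : Gr F n s, ∑ L : Gr F n r,
          g L * (if M ≤ S.1 ∧ S.1 ≤ L.1 then (1 : ℝ) else 0) := by
        refine Finset.sum_congr rfl fun S _ => ?_
        by_cases h : M ≤ S.1 <;> simp [h, sumAbove]
    _ = ∑ L : Gr F n r, g L * ∑ S : Gr F n s,
          (if M ≤ S.1 ∧ S.1 ≤ L.1 then (1 : ℝ) else 0) := by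
        rw [Finset.sum_comm]
        simp only [Finset.mul_sum]
    _ = _ := by
        rw [sumAbove, Finset.mul_sum]
        refine Finset.sum_congr rfl fun L _ => ?_
        by_cases h : M ≤ L.1
        · rw [sum_gr_between h, L.2, if_pos h, mul_comm]
        · rw [if_neg h, Finset.sum_eq_zero, mul_zero, mul_zero]
          exact fun S _ => if_neg fun hS => h (hS.1.trans hS.2)

theorem IsNullFunction.sumAbove_eq_zero {g : Gr F n r → ℝ} (hg : IsNullFunction g)
    (M : Submodule F (Fin n → F)) (hM : finrank F M < r) : sumAbove g M = 0 := by
  have h := sumAbove_sumAbove (s := r - 1) g M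
  have h0 : sumAbove (fun S : Gr F n (r - 1) => sumAbove g S.1) M = 0 :=
    Finset.sum_eq_zero fun S _ => by
      dsimp only
      rw [hg S.1 (by rw [S.2]; omega), ite_self]
  rw [h0] at h
  refine (mul_eq_zero.1 h.symm).resolve_left (qBinom_pos (one_lt_card_real F) ?_ ?_).ne' <;>
    omega

theorem sumAbove_of_finrank_eq (g : Gr F n r → ℝ) (M : Gr F n r) : sumAbove g M.1 = g M := by
  classical
  rw [sumAbove, Finset.sum_eq_single M]
  · simp
  · intro L _ hL
    refine if_neg fun h => hL (Subtype.ext ?_)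
    exact (Submodule.eq_of_le_of_finrank_eq h (by rw [M.2, L.2])).symm
  · simp

theorem sumBelow_of_finrank_eq (g : Gr F n r → ℝ) (M : Gr F n r) : sumBelow g M.1 = g M := by
  classical
  rw [sumBelow, Finset.sum_eq_single M]
  · simp
  · intro L _ hL
    refine if_neg fun h => hL (Subtype.ext ?_)
    exact Submodule.eq_of_le_of_finrank_eq h (by rw [M.2, L.2])
  · simp

open Classical in
/-- Möbius inversion in the subspace lattice: the sum of `μ(0, M)` over all `M ≤ W` is `1` if
`W = 0` and `0` otherwise. -/
theorem sum_mobius_subspace (W : Submodule F (Fin n → F)) (R : ℕ) (hR : finrank F W ≤ R) :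
    ∑ m ∈ Finset.range (R + 1), (-1 : ℝ) ^ m * (Fintype.card F : ℝ) ^ (m.choose 2) *
      ∑ M : Gr F n m, (if M.1 ≤ W then (1 : ℝ) else 0) = if W = ⊥ then 1 else 0 := by
  have hc : ∀ m : ℕ, ∑ M : Gr F n m, (if M.1 ≤ W then (1 : ℝ) else 0) =
      qBinom (Fintype.card F) (finrank F W) m := by
    intro m
    have h := sum_gr_between (k := m) (bot_le : ⊥ ≤ W)
    simpa using h
  simp only [hc]
  have h := alternating_sum_qBinom (one_lt_card_real F) (finrank F W)
  simp only [Submodule.finrank_eq_zero] at h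
  rw [← h]
  symm
  refine Finset.sum_subset (Finset.range_subset_range.2 (by omega)) fun m _ hm => ?_
  rw [Finset.mem_range, not_lt] at hm
  rw [qBinom_eq_zero (by omega) (by omega), mul_zero]

open Classical in
/-- For a null function, summing over the subspaces that meet `S` trivially is, up to an explicit
factor, the same as summing over those contained in `S`: after Möbius inversion only the subspaces
of full dimension `r` survive. -/
theorem IsNullFunction.sum_disjoint {g : Gr F n r → ℝ} (hg : IsNullFunction g)
    (S : Submodule F (Fin n → F)) :
    ∑ L : Gr F n r, (if Disjoint L.1 S then g L else 0) =
      (-1) ^ r * (Fintype.card F : ℝ) ^ (r.choose 2) * sumBelow g S := by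
  calc ∑ L : Gr F n r, (if Disjoint L.1 S then g L else 0)
      = ∑ L : Gr F n r, ∑ m ∈ Finset.range (r + 1), ∑ M : Gr F n m,
          ((-1 : ℝ) ^ m * (Fintype.card F : ℝ) ^ (m.choose 2) *
            (if M.1 ≤ S then (if M.1 ≤ L.1 then g L else 0) else 0)) := by
        refine Finset.sum_congr rfl fun L _ => ?_
        have h := sum_mobius_subspace (L.1 ⊓ S) r
          ((Submodule.finrank_mono inf_le_left).trans L.2.le)
        simp only [disjoint_iff]
        rw [← mul_boole, ← h, Finset.mul_sum]
        refine Finset.sum_congr rfl fun m _ => ?_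
        rw [Finset.mul_sum, Finset.mul_sum]
        refine Finset.sum_congr rfl fun M _ => ?_
        rw [mul_left_comm]
        congr 1
        by_cases h1 : M.1 ≤ L.1 <;> by_cases h2 : M.1 ≤ S <;> simp [h1, h2]
    _ = ∑ m ∈ Finset.range (r + 1), (-1 : ℝ) ^ m * (Fintype.card F : ℝ) ^ (m.choose 2) *
          sumBelow (fun M : Gr F n m => sumAbove g M.1) S := by
        rw [Finset.sum_comm]
        refine Finset.sum_congr rfl fun m _ => ?_
        rw [Finset.sum_comm, sumBelow, Finset.mul_sum]
        refine Finset.sum_congr rfl fun M _ => ?_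
        rw [← Finset.mul_sum]
        by_cases h2 : M.1 ≤ S <;> simp [h2, sumAbove]
    _ = _ := by
        rw [Finset.sum_eq_single r]
        · simp only [sumAbove_of_finrank_eq]
        · intro m hm hmr
          have hm := Finset.mem_range.1 hm
          rw [sumBelow, Finset.sum_eq_zero, mul_zero]
          intro M _
          rw [hg.sumAbove_eq_zero M.1 (by rw [M.2]; omega), ite_self]
        · simp

open Classical in
/-- Summing over the `k`-dimensional subspaces that meet `S` trivially the function induced by a
null function `g` returns a multiple of the sum of `g` over the subspaces of `S`. -/
theorem IsNullFunction.sum_disjoint_sumBelow {g : Gr F n r → ℝ} (hg : IsNullFunction g)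
    (S : Submodule F (Fin n → F)) (k : ℕ) :
    ∑ Y : Gr F n k, (if Disjoint Y.1 S then sumBelow g Y.1 else 0) =
      (-1) ^ r * (Fintype.card F : ℝ) ^ (r.choose 2) *
        ((Fintype.card F : ℝ) ^ ((finrank F S : ℤ) * (k - r)) *
          qBinom (Fintype.card F) ((n : ℤ) - r - finrank F S) ((k : ℤ) - r)) *
        sumBelow g S := by
  calc ∑ Y : Gr F n k, (if Disjoint Y.1 S then sumBelow g Y.1 else 0)
      = ∑ Y : Gr F n k, ∑ L : Gr F n r,
          g L * (if L.1 ≤ Y.1 ∧ Y.1 ≤ ⊤ ∧ Disjoint Y.1 S then (1 : ℝ) else 0) := by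
        refine Finset.sum_congr rfl fun Y _ => ?_
        by_cases h : Disjoint Y.1 S <;> simp [h, sumBelow]
    _ = ∑ L : Gr F n r, g L * ∑ Y : Gr F n k,
          (if L.1 ≤ Y.1 ∧ Y.1 ≤ ⊤ ∧ Disjoint Y.1 S then (1 : ℝ) else 0) := by
        rw [Finset.sum_comm]
        simp only [Finset.mul_sum]
    _ = ((Fintype.card F : ℝ) ^ ((finrank F S : ℤ) * (k - r)) *
          qBinom (Fintype.card F) ((n : ℤ) - r - finrank F S) ((k : ℤ) - r)) *
          ∑ L : Gr F n r, (if Disjoint L.1 S then g L else 0) := by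
        rw [Finset.mul_sum]
        refine Finset.sum_congr rfl fun L _ => ?_
        by_cases h : Disjoint L.1 S
        · rw [sum_gr_between_disjoint le_top le_top h, L.2, if_pos h, finrank_top,
            finrank_fin_fun, mul_comm]
        · rw [if_neg h, Finset.sum_eq_zero, mul_zero, mul_zero]
          exact fun Y _ => if_neg fun hY => h (hY.2.2.mono_left hY.1)
    _ = _ := by
        rw [hg.sum_disjoint]
        ring

open Classical in
/-- The matrix on the `k`-dimensional subspaces whose `(X, Y)`-entry is the number of
`s`-dimensional subspaces of `X` that meet `Y` trivially. -/
noncomputable def avoidMatrix (F : Type*) [Field F] [Fintype F] (n k s : ℕ) :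
    Matrix (Gr F n k) (Gr F n k) ℝ :=
  Matrix.of fun X Y => ∑ S : Gr F n s, if S.1 ≤ X.1 ∧ Disjoint Y.1 S.1 then 1 else 0

/-- The eigenvalue of `avoidMatrix F n k s` on the `r`-th eigenspace. -/
noncomputable def avoidEigenvalue (q : ℝ) (n k s r : ℕ) : ℝ :=
  (-1) ^ r * q ^ (r.choose 2) * (q ^ ((s : ℤ) * (k - r)) *
    qBinom q ((n : ℤ) - r - s) ((k : ℤ) - r)) * qBinom q ((k : ℤ) - r) ((s : ℤ) - r)

theorem avoidMatrix_apply (X Y : Gr F n k) :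
    avoidMatrix F n k s X Y =
      (Fintype.card F : ℝ) ^ (finrank F ↥(X.1 ⊓ Y.1) * s) *
        qBinom (Fintype.card F) ((k : ℤ) - finrank F ↥(X.1 ⊓ Y.1)) s := by
  classical
  have h := sum_gr_between_disjoint (k := s) (inf_le_left : X.1 ⊓ Y.1 ≤ X.1) bot_le disjoint_bot_left
  rw [finrank_bot, X.2] at h
  simp only [Nat.cast_zero, sub_zero, ← Nat.cast_mul, zpow_natCast] at h
  rw [← h, avoidMatrix, Matrix.of_apply]
  refine Finset.sum_congr rfl fun S _ => ?_
  refine if_congr ?_ rfl rfl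
  simp only [bot_le, true_and]
  refine and_congr_right fun hS => ?_
  rw [disjoint_comm, disjoint_iff, disjoint_iff, ← inf_assoc, inf_eq_left.2 hS]

theorem IsNullFunction.avoidMatrix_mulVec {g : Gr F n r → ℝ} (hg : IsNullFunction g) :
    (avoidMatrix F n k s).mulVec (fun Y => sumBelow g Y.1) =
      avoidEigenvalue (Fintype.card F) n k s r • fun Y => sumBelow g Y.1 := by
  classical
  funext X
  calc (avoidMatrix F n k s).mulVec (fun Y => sumBelow g Y.1) X
      = ∑ Y : Gr F n k, ∑ S : Gr F n s,
          (if S.1 ≤ X.1 then (if Disjoint Y.1 S.1 then sumBelow g Y.1 else 0) else 0) := by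
        simp only [Matrix.mulVec, dotProduct, avoidMatrix, Matrix.of_apply, Finset.sum_mul]
        refine Finset.sum_congr rfl fun Y _ => Finset.sum_congr rfl fun S _ => ?_
        by_cases h1 : S.1 ≤ X.1 <;> by_cases h2 : Disjoint Y.1 S.1 <;> simp [h1, h2]
    _ = ∑ S : Gr F n s, (if S.1 ≤ X.1 then
          ((-1) ^ r * (Fintype.card F : ℝ) ^ (r.choose 2) *
            ((Fintype.card F : ℝ) ^ ((s : ℤ) * (k - r)) *
              qBinom (Fintype.card F) ((n : ℤ) - r - s) ((k : ℤ) - r))) * sumBelow g S.1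
          else 0) := by
        rw [Finset.sum_comm]
        refine Finset.sum_congr rfl fun S _ => ?_
        by_cases h : S.1 ≤ X.1
        · simp only [if_pos h]
          rw [hg.sum_disjoint_sumBelow, S.2]
        · simp [h]
    _ = ((-1) ^ r * (Fintype.card F : ℝ) ^ (r.choose 2) *
            ((Fintype.card F : ℝ) ^ ((s : ℤ) * (k - r)) *
              qBinom (Fintype.card F) ((n : ℤ) - r - s) ((k : ℤ) - r))) *
          sumBelow (fun S : Gr F n s => sumBelow g S.1) X.1 := by
        rw [sumBelow, Finset.mul_sum]
        exact Finset.sum_congr rfl fun S _ => by rw [mul_ite, mul_zero]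
    _ = _ := by
        rw [sumBelow_sumBelow, X.2, Pi.smul_apply, smul_eq_mul, avoidEigenvalue]
        ring

end

/-! ### Decomposition into eigenspaces -/

section

open Module

variable {F : Type*} [Field F] [Fintype F] {n r s k : ℕ}

theorem sumBelow_add (g h : Gr F n r → ℝ) (K : Submodule F (Fin n → F)) :
    sumBelow (g + h) K = sumBelow g K + sumBelow h K := by
  classical
  rw [sumBelow, sumBelow, sumBelow, ← Finset.sum_add_distrib]
  exact Finset.sum_congr rfl fun L _ => by split_ifs <;> simp

theorem sumBelow_smul (c : ℝ) (g : Gr F n r → ℝ) (K : Submodule F (Fin n → F)) :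
    sumBelow (c • g) K = c * sumBelow g K := by
  classical
  rw [sumBelow, sumBelow, Finset.mul_sum]
  exact Finset.sum_congr rfl fun L _ => by split_ifs <;> simp

theorem sumAbove_add (g h : Gr F n r → ℝ) (M : Submodule F (Fin n → F)) :
    sumAbove (g + h) M = sumAbove g M + sumAbove h M := by
  classical
  rw [sumAbove, sumAbove, sumAbove, ← Finset.sum_add_distrib]
  exact Finset.sum_congr rfl fun L _ => by split_ifs <;> simp

theorem sumAbove_smul (c : ℝ) (g : Gr F n r → ℝ) (M : Submodule F (Fin n → F)) :
    sumAbove (c • g) M = c * sumAbove g M := by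
  classical
  rw [sumAbove, sumAbove, Finset.mul_sum]
  exact Finset.sum_congr rfl fun L _ => by split_ifs <;> simp

theorem mem_grassmannEigenspace {f : Gr F n k → ℝ} :
    f ∈ grassmannEigenspace F n k r ↔
      ∃ g : Gr F n r → ℝ, IsNullFunction g ∧ f = fun K => sumBelow g K.1 := by
  constructor
  · intro hf
    refine Submodule.span_induction (p := fun f _ => ∃ g : Gr F n r → ℝ, IsNullFunction g ∧
      f = fun K => sumBelow g K.1) ?_ ?_ ?_ ?_ hf
    · rintro f ⟨g, hg, rfl⟩
      exact ⟨g, hg, rfl⟩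
    · refine ⟨0, fun M _ => ?_, ?_⟩
      · simp [sumAbove]
      · funext K
        simp [sumBelow]
    · rintro _ _ _ _ ⟨g, hg, rfl⟩ ⟨h, hh, rfl⟩
      refine ⟨g + h, fun M hM => ?_, ?_⟩
      · rw [sumAbove_add, hg M hM, hh M hM, add_zero]
      · funext K
        rw [sumBelow_add, Pi.add_apply]
    · rintro c _ _ ⟨g, hg, rfl⟩
      refine ⟨c • g, fun M hM => ?_, ?_⟩
      · rw [sumAbove_smul, hg M hM, mul_zero]
      · funext K
        rw [sumBelow_smul, Pi.smul_apply, smul_eq_mul]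
  · rintro ⟨g, hg, rfl⟩
    exact Submodule.subset_span ⟨g, hg, rfl⟩

theorem avoidMatrix_mulVec_of_mem {f : Gr F n k → ℝ} (hf : f ∈ grassmannEigenspace F n k r)
    (s : ℕ) :
    (avoidMatrix F n k s).mulVec f = avoidEigenvalue (Fintype.card F) n k s r • f := by
  obtain ⟨g, hg, rfl⟩ := mem_grassmannEigenspace.1 hf
  exact hg.avoidMatrix_mulVec

theorem avoidEigenvalue_of_lt (q : ℝ) (h : s < r) : avoidEigenvalue q n k s r = 0 := by
  rw [avoidEigenvalue, qBinom_of_neg _ ((k : ℤ) - r) (by omega), mul_zero]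

theorem avoidEigenvalue_ne_zero {q : ℝ} (hq : 1 < q) (hkn : 2 * k ≤ n) (hrs : r ≤ s)
    (hsk : s ≤ k) : avoidEigenvalue q n k s r ≠ 0 := by
  have hq0 : q ≠ 0 := by linarith
  have h1 : qBinom q ((n : ℤ) - r - s) ((k : ℤ) - r) ≠ 0 :=
    (qBinom_pos hq (by omega) (by omega)).ne'
  have h2 : qBinom q ((k : ℤ) - r) ((s : ℤ) - r) ≠ 0 :=
    (qBinom_pos hq (by omega) (by omega)).ne'
  rw [avoidEigenvalue]
  exact mul_ne_zero (mul_ne_zero (mul_ne_zero (by simp) (pow_ne_zero _ hq0))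
    (mul_ne_zero (zpow_ne_zero _ hq0) h1)) h2

/-- Independence holds because the matrices `avoidMatrix F n k s`, `s = 0, …, k`, have a triangular
table of eigenvalues with nonzero diagonal. -/
theorem iSupIndep_grassmannEigenspace (hkn : 2 * k ≤ n) :
    iSupIndep fun r : Fin (k + 1) => grassmannEigenspace F n k r := by
  rw [iSupIndep_iff_finsetSum_eq_zero_imp_eq_zero]
  intro T v hv h0 i
  -- Applying `avoidMatrix F n k i` kills the components beyond `i`; those before `i` vanish by
  -- induction.
  induction i using WellFoundedLT.induction with
  | _ i ih =>
    intro hi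
    have h1 := congrArg (avoidMatrix F n k i).mulVecLin h0
    rw [map_sum, map_zero, Finset.sum_eq_single_of_mem i hi] at h1
    · rw [Matrix.mulVecLin_apply, avoidMatrix_mulVec_of_mem (hv i hi)] at h1
      exact (smul_eq_zero.1 h1).resolve_left
        (avoidEigenvalue_ne_zero (one_lt_card_real F) hkn le_rfl (by omega))
    · intro j hj hji
      rw [Matrix.mulVecLin_apply, avoidMatrix_mulVec_of_mem (hv j hj)]
      rcases lt_or_gt_of_ne hji with h | h
      · rw [ih j h hj, smul_zero]
      · rw [avoidEigenvalue_of_lt _ h, zero_smul]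

theorem card_gr (F : Type*) [Field F] [Fintype F] (n r : ℕ) :
    (Fintype.card (Gr F n r) : ℝ) = qBinom (Fintype.card F) n r := by
  classical
  have h := sum_gr_between (F := F) (k := r) (bot_le : ⊥ ≤ (⊤ : Submodule F (Fin n → F)))
  simpa using h

open Classical in
/-- Inclusion of `s`-dimensional in `r`-dimensional subspaces. -/
noncomputable def inclusionMatrix (F : Type*) [Field F] (n r s : ℕ) :
    Matrix (Gr F n r) (Gr F n s) ℝ :=
  Matrix.of fun L M => if M.1 ≤ L.1 then 1 else 0

theorem inclusionMatrix_mulVec (h : Gr F n s → ℝ) :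
    (inclusionMatrix F n r s).mulVec h = fun L => sumBelow h L.1 := by
  funext L
  simp [Matrix.mulVec, dotProduct, inclusionMatrix, sumBelow]

theorem inclusionMatrix_transpose_mulVec (g : Gr F n r → ℝ) :
    (inclusionMatrix F n r s).transpose.mulVec g = fun M => sumAbove g M.1 := by
  funext L
  simp [Matrix.mulVec, dotProduct, inclusionMatrix, sumAbove]

/-- Solvability of the normal equations over `ℝ`. -/
theorem Matrix.exists_transpose_mulVec_sub_eq_zero {m l : Type*} [Fintype m] [Fintype l]
    (A : Matrix m l ℝ) (g : m → ℝ) : ∃ h : l → ℝ, A.transpose.mulVec (g - A.mulVec h) = 0 := by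
  classical
  have hle : LinearMap.range (A.transpose * A).mulVecLin ≤ LinearMap.range A.transpose.mulVecLin := by
    rintro _ ⟨h, rfl⟩
    exact ⟨A.mulVec h, by simp⟩
  have heq := Submodule.eq_of_le_of_finrank_eq hle
    ((A.rank_transpose_mul_self).trans A.rank_transpose.symm)
  have hmem : A.transpose.mulVec g ∈ LinearMap.range (A.transpose * A).mulVecLin := by
    rw [heq]
    exact ⟨g, rfl⟩
  obtain ⟨h, hh⟩ := hmem
  refine ⟨h, ?_⟩
  rw [Matrix.mulVec_sub, sub_eq_zero, Matrix.mulVec_mulVec]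
  exact hh.symm

/-- Every function splits as a null function plus one induced from dimension `r`. -/
theorem exists_null_add_sumBelow (g : Gr F n (r + 1) → ℝ) :
    ∃ (g₀ : Gr F n (r + 1) → ℝ) (h : Gr F n r → ℝ), IsNullFunction g₀ ∧
      g = g₀ + fun L => sumBelow h L.1 := by
  obtain ⟨h, hh⟩ := (inclusionMatrix F n (r + 1) r).exists_transpose_mulVec_sub_eq_zero g
  refine ⟨g - (inclusionMatrix F n (r + 1) r).mulVec h, h, fun M hM => ?_, ?_⟩
  · rw [inclusionMatrix_transpose_mulVec] at hh
    exact congrFun hh ⟨M, by omega⟩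
  · rw [inclusionMatrix_mulVec, sub_add_cancel]

/-- Peeling off null functions dimension by dimension shows that the eigenspaces span. -/
theorem sumBelow_mem_iSup (k : ℕ) (r : ℕ) (hr : r ≤ k) (g : Gr F n r → ℝ) :
    (fun K : Gr F n k => sumBelow g K.1) ∈
      ⨆ i : Fin (k + 1), grassmannEigenspace F n k i := by
  induction r with
  | zero =>
    refine Submodule.mem_iSup_of_mem (0 : Fin (k + 1)) (mem_grassmannEigenspace.2 ⟨g, ?_, rfl⟩)
    intro M hM
    simp at hM
  | succ r ih =>
    obtain ⟨g₀, h, hg₀, rfl⟩ := exists_null_add_sumBelow g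
    have e : (fun K : Gr F n k => sumBelow (g₀ + fun L => sumBelow h L.1) K.1) =
        (fun K => sumBelow g₀ K.1) + qBinom (Fintype.card F) ((k : ℤ) - r)
          (((r + 1 : ℕ) : ℤ) - r) • fun K => sumBelow h K.1 := by
      funext K
      rw [sumBelow_add, sumBelow_sumBelow, K.2]
      simp
    rw [e]
    refine add_mem (Submodule.mem_iSup_of_mem (⟨r + 1, by omega⟩ : Fin (k + 1)) ?_)
      (Submodule.smul_mem _ _ (ih (by omega) h))
    exact mem_grassmannEigenspace.2 ⟨g₀, hg₀, rfl⟩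

theorem iSup_grassmannEigenspace :
    ⨆ i : Fin (k + 1), grassmannEigenspace F n k i = ⊤ := by
  refine eq_top_iff.2 fun f _ => ?_
  have h := sumBelow_mem_iSup k k le_rfl f
  simpa only [sumBelow_of_finrank_eq] using h

theorem isInternal_grassmannEigenspace (hkn : 2 * k ≤ n) :
    DirectSum.IsInternal fun r : Fin (k + 1) => grassmannEigenspace F n k r :=
  DirectSum.isInternal_submodule_of_iSupIndep_of_iSup_eq_top
    (iSupIndep_grassmannEigenspace hkn) iSup_grassmannEigenspace

/-- Nonzero null functions exist because there are more `r`-dimensional than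
`(r - 1)`-dimensional subspaces. -/
theorem exists_isNullFunction_ne_zero (hrn : 2 * r ≤ n) :
    ∃ g : Gr F n r → ℝ, IsNullFunction g ∧ g ≠ 0 := by
  have hq := one_lt_card_real F
  cases r with
  | zero =>
    refine ⟨1, fun M hM => by simp at hM, fun h => ?_⟩
    have := congrFun h ⟨⊥, by simp⟩
    simp at this
  | succ r =>
    have hlt : Fintype.card (Gr F n r) < Fintype.card (Gr F n (r + 1)) := by
      have h1 := qBinom_succ_mul' hq n r
      have h2 : (0 : ℝ) < qBinom (Fintype.card F) n r := qBinom_pos hq (by omega) (by omega)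
      have h3 : (Fintype.card F : ℝ) ^ ((r : ℤ) + 1) - 1 <
          (Fintype.card F : ℝ) ^ ((n : ℤ) - r) - 1 :=
        sub_lt_sub_right (zpow_lt_zpow_right₀ hq (by omega)) 1
      have h4 : (0 : ℝ) < (Fintype.card F : ℝ) ^ ((r : ℤ) + 1) - 1 :=
        sub_pos.2 (one_lt_zpow₀ hq (by omega))
      rw [← Nat.cast_lt (α := ℝ), card_gr, card_gr]
      refine lt_of_mul_lt_mul_right ?_ h4.le
      rw [h1]
      exact mul_lt_mul_of_pos_left h3 h2
    have hker := LinearMap.ker_ne_bot_of_finrank_lt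
      (f := (inclusionMatrix F n (r + 1) r).transpose.mulVecLin) (by simpa using hlt)
    obtain ⟨g, hg, hg0⟩ := Submodule.exists_mem_ne_zero_of_ne_bot hker
    refine ⟨g, fun M hM => ?_, hg0⟩
    rw [LinearMap.mem_ker, Matrix.mulVecLin_apply, inclusionMatrix_transpose_mulVec] at hg
    exact congrFun hg ⟨M, by omega⟩

theorem grassmannEigenspace_ne_bot (hkn : 2 * k ≤ n) (hrk : r ≤ k) :
    grassmannEigenspace F n k r ≠ ⊥ := by
  classical
  have hq := one_lt_card_real F
  have hq0 : (Fintype.card F : ℝ) ≠ 0 := by linarith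
  obtain ⟨g, hg, hg0⟩ := exists_isNullFunction_ne_zero (F := F) (n := n) (r := r) (by omega)
  intro hbot
  have hmem : (fun K => sumBelow g K.1) ∈ grassmannEigenspace F n k r :=
    mem_grassmannEigenspace.2 ⟨g, hg, rfl⟩
  rw [hbot, Submodule.mem_bot] at hmem
  refine hg0 (funext fun S => ?_)
  have h := hg.sum_disjoint_sumBelow S.1 k
  rw [Finset.sum_eq_zero fun Y _ => by rw [congrFun hmem Y]; simp, sumBelow_of_finrank_eq,
    S.2] at h
  have h1 : qBinom (Fintype.card F) ((n : ℤ) - r - r) ((k : ℤ) - r) ≠ 0 :=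
    (qBinom_pos hq (by omega) (by omega)).ne'
  refine (mul_eq_zero.1 h.symm).resolve_left ?_
  exact mul_ne_zero (mul_ne_zero (by simp) (pow_ne_zero _ hq0))
    (mul_ne_zero (zpow_ne_zero _ hq0) h1)

end

/-! ### The Gram matrix of the Steiner systems -/

section

open Module

theorem exists_linearEquiv_of_isCompl {F V V' : Type*} [Field F] [AddCommGroup V] [Module F V]
    [AddCommGroup V'] [Module F V'] {A B : Submodule F V} {A' B' : Submodule F V'}
    (h : IsCompl A B) (h' : IsCompl A' B') (eA : A ≃ₗ[F] A') (eB : B ≃ₗ[F] B') :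
    ∃ e : V ≃ₗ[F] V', (∀ a : A, e a = eA a) ∧ ∀ b : B, e b = eB b := by
  refine ⟨(A.prodEquivOfIsCompl B h).symm ≪≫ₗ LinearEquiv.prodCongr eA eB ≪≫ₗ
    A'.prodEquivOfIsCompl B' h', fun a => ?_, fun b => ?_⟩ <;> simp

theorem exists_linearEquiv_map_eq {F V V' : Type*} [Field F] [AddCommGroup V] [Module F V]
    [AddCommGroup V'] [Module F V'] [FiniteDimensional F V] [FiniteDimensional F V']
    (D : Submodule F V) (D' : Submodule F V') (hV : finrank F V = finrank F V')
    (hD : finrank F D = finrank F D') :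
    ∃ e : V ≃ₗ[F] V', D.map (e : V →ₗ[F] V') = D' := by
  obtain ⟨C, hC⟩ := D.exists_isCompl
  obtain ⟨C', hC'⟩ := D'.exists_isCompl
  have h1 := Submodule.finrank_add_eq_of_isCompl hC
  have h2 := Submodule.finrank_add_eq_of_isCompl hC'
  obtain ⟨e, he, -⟩ := exists_linearEquiv_of_isCompl hC hC' (LinearEquiv.ofFinrankEq D D' hD)
    (LinearEquiv.ofFinrankEq C C' (by omega))
  refine ⟨e, Submodule.eq_of_le_of_finrank_eq ?_ ((LinearEquiv.finrank_map_eq e D).trans hD)⟩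
  rintro _ ⟨x, hx, rfl⟩
  have := he ⟨x, hx⟩
  simp only at this
  simp [this]

/-- The general linear group acts transitively on the pairs of subspaces with prescribed dimensions
and prescribed dimension of the intersection: `Y` is the sum of `X ⊓ Y` and a subspace of a suitable
complement of `X`, so an isomorphism can be built separately on `X` and on that complement. -/
theorem exists_linearEquiv_map_pair {F V : Type*} [Field F] [AddCommGroup V] [Module F V]
    [FiniteDimensional F V] {X Y X' Y' : Submodule F V} (hX : finrank F X = finrank F X')
    (hY : finrank F Y = finrank F Y')
    (hXY : finrank F ↥(X ⊓ Y) = finrank F ↥(X' ⊓ Y')) :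
    ∃ e : V ≃ₗ[F] V, X.map (e : V →ₗ[F] V) = X' ∧ Y.map (e : V →ₗ[F] V) = Y' := by
  have split : ∀ X Y : Submodule F V, ∃ D W : Submodule F V, X ⊓ Y ⊔ D = Y ∧
      finrank F ↥(X ⊓ Y) + finrank F D = finrank F Y ∧ D ≤ W ∧ IsCompl X W := by
    intro X Y
    obtain ⟨D, hdis, hsup⟩ := IsModularLattice.exists_disjoint_and_sup_eq
      (inf_le_right : X ⊓ Y ≤ Y)
    have hDY : D ≤ Y := hsup ▸ le_sup_right
    have hDX : Disjoint D X := by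
      rw [disjoint_iff, inf_comm, ← inf_eq_right.2 hDY, ← inf_assoc]
      exact hdis.eq_bot
    obtain ⟨W, hDW, hW⟩ := hDX.exists_isCompl
    refine ⟨D, W, hsup, ?_, hDW, hW.symm⟩
    have := Submodule.finrank_sup_add_finrank_inf_eq (X ⊓ Y) D
    rw [hdis.eq_bot, finrank_bot, hsup] at this
    omega
  obtain ⟨D, W, h1, h2, h3, h4⟩ := split X Y
  obtain ⟨D', W', h1', h2', h3', h4'⟩ := split X' Y'
  have h5 := Submodule.finrank_add_eq_of_isCompl h4
  have h5' := Submodule.finrank_add_eq_of_isCompl h4'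
  have fr : ∀ {P Q : Submodule F V}, P ≤ Q → finrank F (P.submoduleOf Q) = finrank F P :=
    fun h => (Submodule.submoduleOfEquivOfLe h).finrank_eq
  obtain ⟨eX, heX⟩ := exists_linearEquiv_map_eq ((X ⊓ Y).submoduleOf X)
    ((X' ⊓ Y').submoduleOf X') hX (by rw [fr inf_le_left, fr inf_le_left, hXY])
  obtain ⟨eW, heW⟩ := exists_linearEquiv_map_eq (D.submoduleOf W) (D'.submoduleOf W')
    (by omega) (by rw [fr h3, fr h3']; omega)
  obtain ⟨e, he1, he2⟩ := exists_linearEquiv_of_isCompl h4 h4' eX eW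
  refine ⟨e, Submodule.eq_of_le_of_finrank_eq ?_ ((LinearEquiv.finrank_map_eq e X).trans hX),
    Submodule.eq_of_le_of_finrank_eq ?_ ((LinearEquiv.finrank_map_eq e Y).trans hY)⟩
  · rintro _ ⟨x, hx, rfl⟩
    have := he1 ⟨x, hx⟩
    simp only at this
    simp [this]
  · rw [← h1, Submodule.map_sup]
    refine sup_le ?_ ?_
    · rintro _ ⟨x, hx, rfl⟩
      have h := he1 ⟨x, hx.1⟩
      have hm : eX ⟨x, hx.1⟩ ∈ (X' ⊓ Y').submoduleOf X' := by
        rw [← heX]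
        exact ⟨⟨x, hx.1⟩, hx, rfl⟩
      change e x ∈ Y'
      rw [show e x = _ from h]
      exact hm.2
    · rintro _ ⟨x, hx, rfl⟩
      have h := he2 ⟨x, h3 hx⟩
      have hm : eW ⟨x, h3 hx⟩ ∈ D'.submoduleOf W' := by
        rw [← heW]
        exact ⟨⟨x, h3 hx⟩, hx, rfl⟩
      change e x ∈ Y'
      rw [show e x = _ from h, ← h1']
      exact Submodule.mem_sup_right hm

variable {F : Type*} [Field F] {n t r k : ℕ}

/-- The action of a linear automorphism on the Grassmannian. -/
def Gr.congr (k : ℕ) (e : (Fin n → F) ≃ₗ[F] (Fin n → F)) : Gr F n k ≃ Gr F n k :=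
  (Submodule.orderIsoMapComap e).toEquiv.subtypeEquiv fun X => by
    change _ ↔ finrank F (X.map (e : (Fin n → F) →ₗ[F] (Fin n → F))) = k
    rw [LinearEquiv.finrank_map_eq]

theorem Gr.congr_le_congr (e : (Fin n → F) ≃ₗ[F] (Fin n → F)) (T : Gr F n t) (X : Gr F n k) :
    (Gr.congr t e T).1 ≤ (Gr.congr k e X).1 ↔ T.1 ≤ X.1 :=
  (Submodule.orderIsoMapComap e).le_iff_le

/-- The action of a linear automorphism on the `q`-Steiner systems. -/
def SteinerSystem.congr (t k : ℕ) (e : (Fin n → F) ≃ₗ[F] (Fin n → F)) :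
    SteinerSystem F t k n ≃ SteinerSystem F t k n :=
  (Equiv.Set.congr (Gr.congr k e)).subtypeEquiv fun B => by
    refine (Gr.congr t e).forall_congr fun {T} => ?_
    refine (Gr.congr k e).existsUnique_congr fun X => ?_
    rw [Gr.congr_le_congr]
    refine and_congr_left fun _ => ?_
    change _ ↔ Gr.congr k e X ∈ Gr.congr k e '' B
    rw [(Gr.congr k e).injective.mem_set_image]

theorem SteinerSystem.congr_mem_congr (e : (Fin n → F) ≃ₗ[F] (Fin n → F))
    (B : SteinerSystem F t k n) (X : Gr F n k) :
    Gr.congr k e X ∈ (SteinerSystem.congr t k e B).1 ↔ X ∈ B.1 := by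
  change Gr.congr k e X ∈ Gr.congr k e '' B.1 ↔ _
  rw [(Gr.congr k e).injective.mem_set_image]

variable [Fintype F]

open Classical in
theorem gramMatrix_apply (X Y : Gr F n k) :
    gramMatrix F t k n X Y =
      ∑ B : SteinerSystem F t k n, if X ∈ B.1 ∧ Y ∈ B.1 then (1 : ℝ) else 0 := by
  simp only [gramMatrix, Matrix.mul_apply, Matrix.transpose_apply, incidenceMatrix,
    Matrix.of_apply]
  refine Finset.sum_congr rfl fun B _ => ?_
  by_cases h1 : X ∈ B.1 <;> by_cases h2 : Y ∈ B.1 <;> simp [h1, h2]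

theorem gramMatrix_self (X : Gr F n k) :
    gramMatrix F t k n X X = blockCount F t k n X := by
  classical
  rw [gramMatrix_apply, blockCount, Nat.card_eq_fintype_card, Fintype.card_subtype]
  simp

theorem gramMatrix_congr (e : (Fin n → F) ≃ₗ[F] (Fin n → F)) (X Y : Gr F n k) :
    gramMatrix F t k n (Gr.congr k e X) (Gr.congr k e Y) = gramMatrix F t k n X Y := by
  classical
  rw [gramMatrix_apply, gramMatrix_apply, ← (SteinerSystem.congr t k e).sum_comp]
  simp only [SteinerSystem.congr_mem_congr]

/-- The entries of the Gram matrix depend only on the dimension of the intersection. -/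
theorem exists_gramMatrix_eq (F : Type*) [Field F] [Fintype F] (t k n : ℕ) : ∃ l : ℕ → ℝ,
    ∀ X Y : Gr F n k, gramMatrix F t k n X Y = l (finrank F ↥(X.1 ⊓ Y.1)) := by
  classical
  refine ⟨fun j => if h : ∃ P : Gr F n k × Gr F n k, finrank F ↥(P.1.1 ⊓ P.2.1) = j then
    gramMatrix F t k n h.choose.1 h.choose.2 else 0, fun X Y => ?_⟩
  have h : ∃ P : Gr F n k × Gr F n k,
      finrank F ↥(P.1.1 ⊓ P.2.1) = finrank F ↥(X.1 ⊓ Y.1) := ⟨(X, Y), rfl⟩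
  beta_reduce
  rw [dif_pos h]
  obtain ⟨e, he1, he2⟩ := exists_linearEquiv_map_pair (X := X.1) (Y := Y.1)
    (X' := h.choose.1.1) (Y' := h.choose.2.1) (by rw [X.2, h.choose.1.2])
    (by rw [Y.2, h.choose.2.2]) h.choose_spec.symm
  rw [← gramMatrix_congr e X Y]
  congr 1
  · exact Subtype.ext he1
  · exact Subtype.ext he2

/-- Two distinct blocks meet in dimension less than `t`. -/
theorem gramMatrix_eq_zero {X Y : Gr F n k} (hXY : X ≠ Y) (ht : t ≤ finrank F ↥(X.1 ⊓ Y.1)) :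
    gramMatrix F t k n X Y = 0 := by
  classical
  rw [gramMatrix_apply]
  refine Finset.sum_eq_zero fun B _ => if_neg fun h => hXY ?_
  have hsum := sum_gr_between (k := t) (bot_le : ⊥ ≤ X.1 ⊓ Y.1)
  rw [finrank_bot] at hsum
  have hpos := qBinom_pos (one_lt_card_real F)
    (N := (finrank F ↥(X.1 ⊓ Y.1) : ℤ) - (0 : ℕ)) (d := (t : ℤ) - (0 : ℕ)) (by omega) (by omega)
  rw [← hsum] at hpos
  obtain ⟨T, -, hT⟩ := Finset.exists_ne_zero_of_sum_ne_zero hpos.ne'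
  have hT : T.1 ≤ X.1 ⊓ Y.1 := by
    by_contra hc
    exact hT (if_neg fun h => hc h.2)
  exact (B.2 T).unique ⟨h.1, hT.trans inf_le_left⟩ ⟨h.2, hT.trans inf_le_right⟩

open Classical in
theorem SteinerSystem.sum_sumBelow_block (B : SteinerSystem F t k n) (h : Gr F n t → ℝ) :
    ∑ Y : Gr F n k, (if Y ∈ B.1 then sumBelow h Y.1 else 0) = sumBelow h ⊤ := by
  calc ∑ Y : Gr F n k, (if Y ∈ B.1 then sumBelow h Y.1 else 0)
      = ∑ T : Gr F n t, ∑ Y : Gr F n k, (if Y ∈ B.1 ∧ T.1 ≤ Y.1 then h T else 0) := by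
        rw [Finset.sum_comm]
        refine Finset.sum_congr rfl fun Y _ => ?_
        by_cases hY : Y ∈ B.1 <;> simp [hY, sumBelow]
    _ = ∑ T : Gr F n t, h T := by
        refine Finset.sum_congr rfl fun T _ => ?_
        obtain ⟨Y, hY, huniq⟩ := B.2 T
        rw [Finset.sum_eq_single Y]
        · exact if_pos hY
        · exact fun Z _ hZ => if_neg fun hZ' => hZ (huniq Z hZ')
        · simp
    _ = _ := by simp [sumBelow]

/-- The Gram matrix acts on functions induced from dimension `r ≤ t` through their total sum. -/
theorem gramMatrix_mulVec_sumBelow (hrt : r ≤ t) (htk : t ≤ k) (g : Gr F n r → ℝ)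
    (X : Gr F n k) :
    (gramMatrix F t k n).mulVec (fun Y => sumBelow g Y.1) X =
      gramMatrix F t k n X X * (qBinom (Fintype.card F) ((n : ℤ) - r) ((t : ℤ) - r) /
        qBinom (Fintype.card F) ((k : ℤ) - r) ((t : ℤ) - r) * sumBelow g ⊤) := by
  classical
  have hne : qBinom (Fintype.card F) ((k : ℤ) - r) ((t : ℤ) - r) ≠ 0 :=
    (qBinom_pos (one_lt_card_real F) (by omega) (by omega)).ne'
  -- Each `t`-dimensional subspace lies in one block, so the sum over the blocks of `B` is a sum over
  -- all `t`-dimensional subspaces, whatever `B` is.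
  have key : ∀ B : SteinerSystem F t k n,
      ∑ Y : Gr F n k, (if Y ∈ B.1 then sumBelow g Y.1 else 0) =
        qBinom (Fintype.card F) ((n : ℤ) - r) ((t : ℤ) - r) /
        qBinom (Fintype.card F) ((k : ℤ) - r) ((t : ℤ) - r) * sumBelow g ⊤ := by
    intro B
    have h := B.sum_sumBelow_block fun T => sumBelow g T.1
    rw [sumBelow_sumBelow, finrank_top, finrank_fin_fun] at h
    rw [div_mul_eq_mul_div, eq_div_iff hne, ← h, Finset.sum_mul]
    refine Finset.sum_congr rfl fun Y _ => ?_
    rw [sumBelow_sumBelow, Y.2, ite_mul, zero_mul, mul_comm]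
  calc (gramMatrix F t k n).mulVec (fun Y => sumBelow g Y.1) X
      = ∑ B : SteinerSystem F t k n, (if X ∈ B.1 then
          ∑ Y : Gr F n k, (if Y ∈ B.1 then sumBelow g Y.1 else 0) else 0) := by
        simp only [Matrix.mulVec, dotProduct, gramMatrix_apply, Finset.sum_mul]
        rw [Finset.sum_comm]
        refine Finset.sum_congr rfl fun B _ => ?_
        by_cases hX : X ∈ B.1 <;> simp [hX]
    _ = _ := by
        simp only [key]
        rw [gramMatrix_apply, Finset.sum_mul]
        refine Finset.sum_congr rfl fun B _ => ?_
        by_cases hX : X ∈ B.1 <;> simp [hX]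

theorem gramMatrix_mulVec_zero (htk : t ≤ k) {f : Gr F n k → ℝ}
    (hf : f ∈ grassmannEigenspace F n k 0) (X : Gr F n k) :
    (gramMatrix F t k n).mulVec f X = gramMatrix F t k n X X *
      (qBinom (Fintype.card F) n t / qBinom (Fintype.card F) k t) * f X := by
  obtain ⟨g, -, rfl⟩ := mem_grassmannEigenspace.1 hf
  rw [gramMatrix_mulVec_sumBelow (Nat.zero_le t) htk]
  have hc : ∀ K : Submodule F (Fin n → F), sumBelow g K = ∑ L, g L := by
    intro K
    refine Finset.sum_congr rfl fun L _ => if_pos ?_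
    rw [Submodule.finrank_eq_zero.1 L.2]
    exact bot_le
  simp only [hc, Nat.cast_zero, sub_zero]
  ring

theorem gramMatrix_mulVec_eq_zero (hr : 1 ≤ r) (hrt : r ≤ t) (htk : t ≤ k) {f : Gr F n k → ℝ}
    (hf : f ∈ grassmannEigenspace F n k r) : (gramMatrix F t k n).mulVec f = 0 := by
  obtain ⟨g, hg, rfl⟩ := mem_grassmannEigenspace.1 hf
  funext X
  rw [gramMatrix_mulVec_sumBelow hrt htk]
  have h0 : sumBelow g ⊤ = 0 := by
    rw [← hg.sumAbove_eq_zero ⊥ (by rw [finrank_bot]; omega)]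
    simp [sumBelow, sumAbove]
  rw [h0]
  simp

end

/-! ### Determination of the eigenvalues -/

section

open Module

theorem exists_triangular_solution (c : ℕ → ℕ → ℝ) (t : ℕ)
    (hz : ∀ i j, i < j → j < t → c i j = 0) (hd : ∀ i < t, c i i ≠ 0) (u : ℕ → ℝ) :
    ∃ a : ℕ → ℝ, ∀ j < t, ∑ i ∈ Finset.range t, a i * c i j = u j := by
  induction t generalizing u with
  | zero => exact ⟨0, fun j hj => absurd hj (Nat.not_lt_zero j)⟩
  | succ t ih =>
    obtain ⟨a, ha⟩ := ih (fun i j hij hj => hz i j hij (by omega)) (fun i hi => hd i (by omega))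
      fun j => u j - u t / c t t * c t j
    refine ⟨fun i => if i = t then u t / c t t else a i, fun j hj => ?_⟩
    have h1 : ∑ i ∈ Finset.range t, (if i = t then u t / c t t else a i) * c i j =
        ∑ i ∈ Finset.range t, a i * c i j :=
      Finset.sum_congr rfl fun i hi => by rw [if_neg (Finset.mem_range.1 hi).ne]
    rw [Finset.sum_range_succ, h1]
    beta_reduce
    rw [if_pos rfl]
    rcases Nat.lt_succ_iff_lt_or_eq.1 hj with h | rfl
    · rw [ha j h, sub_add_cancel]
    · rw [Finset.sum_eq_zero fun i hi => by
        rw [hz i j (Finset.mem_range.1 hi) hj, mul_zero], zero_add,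
        div_mul_cancel₀ _ (hd j hj)]

/-- The Gram matrix is a combination of the identity and of the matrices `avoidMatrix F n k s` with
`k - t < s ≤ k`: these span the matrices that depend only on `dim (X ⊓ Y)` and vanish where it is at
least `t`. -/
theorem exists_gramMatrix_eq_sum_avoidMatrix (F : Type*) [Field F] [Fintype F] {t k : ℕ} (n : ℕ)
    (htk : t < k) : ∃ (κ : ℝ) (a : ℕ → ℝ), (∀ X : Gr F n k, (blockCount F t k n X : ℝ) = κ) ∧
      gramMatrix F t k n = κ • (1 : Matrix (Gr F n k) (Gr F n k) ℝ) +
        ∑ i ∈ Finset.range t, a i • avoidMatrix F n k (k - i) := by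
  obtain ⟨l, hl⟩ := exists_gramMatrix_eq F t k n
  have hq := one_lt_card_real F
  have hq0 : (Fintype.card F : ℝ) ≠ 0 := by linarith
  obtain ⟨a, ha⟩ := exists_triangular_solution
    (fun i j => (Fintype.card F : ℝ) ^ (j * (k - i)) *
      qBinom (Fintype.card F) ((k : ℤ) - j) ((k - i : ℕ) : ℤ)) t
    (fun i j hij hj => by
      rw [qBinom_eq_zero (by omega) (by omega), mul_zero])
    (fun i hi => mul_ne_zero (pow_ne_zero _ hq0) (qBinom_pos hq (by omega) (by omega)).ne') l
  have hself : ∀ X : Gr F n k, gramMatrix F t k n X X = l k := by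
    intro X
    have h := hl X X
    rwa [inf_idem, X.2] at h
  refine ⟨l k, a, fun X => ?_, ?_⟩
  · rw [← gramMatrix_self, hself]
  · ext X Y
    rw [Matrix.add_apply, Matrix.smul_apply, Matrix.sum_apply]
    simp only [Matrix.smul_apply, smul_eq_mul, avoidMatrix_apply]
    have hle : finrank F ↥(X.1 ⊓ Y.1) ≤ k := (Submodule.finrank_mono inf_le_left).trans X.2.le
    rcases lt_or_ge (finrank F ↥(X.1 ⊓ Y.1)) t with h | h
    · have hne : X ≠ Y := by
        rintro rfl
        rw [inf_idem, X.2] at h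
        omega
      rw [ha _ h, hl X Y, Matrix.one_apply_ne hne, mul_zero, zero_add]
    · rw [Finset.sum_eq_zero, add_zero]
      · rcases eq_or_ne X Y with rfl | hne
        · rw [hself, Matrix.one_apply_eq, mul_one]
        · rw [gramMatrix_eq_zero hne h, Matrix.one_apply_ne hne, mul_zero]
      · intro i hi
        have hi := Finset.mem_range.1 hi
        rw [qBinom_eq_zero (by omega) (by omega), mul_zero, mul_zero]

/-- The variable `q^r + q^(n+1-r)` in which the eigenvalues of the Grassmann scheme are polynomial,
up to a factor depending only on `r`. -/
noncomputable def eigenVar (q : ℝ) (n r : ℕ) : ℝ := q ^ r + q ^ ((n : ℤ) + 1 - r)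

/-- The factor common to all eigenvalues on the `r`-th eigenspace. -/
noncomputable def eigenFactor (q : ℝ) (n k r : ℕ) : ℝ :=
  (-1) ^ r * q ^ ((r.choose 2 : ℤ) - k * r) * (qFact q (n - k - r) / qFact q (k - r))

theorem eigenFactor_ne_zero {q : ℝ} (hq : 1 < q) (n k r : ℕ) : eigenFactor q n k r ≠ 0 := by
  have hq0 : q ≠ 0 := by linarith
  exact mul_ne_zero (mul_ne_zero (by simp) (zpow_ne_zero _ hq0))
    (div_ne_zero (qFact_pos hq _).ne' (qFact_pos hq _).ne')

theorem eigenVar_injOn {q : ℝ} (hq : 1 < q) {n t : ℕ} (htn : 2 * t ≤ n) :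
    Set.InjOn (eigenVar q n) (Finset.Icc 1 t) := by
  have hq0 : q ≠ 0 := by linarith
  intro r hr r' hr' h
  have hr := Finset.mem_Icc.1 (Finset.mem_coe.1 hr)
  have hr' := Finset.mem_Icc.1 (Finset.mem_coe.1 hr')
  have e1 : q ^ ((n : ℤ) + 1 - r) = q ^ ((n : ℤ) + 1 - r - r') * q ^ r' := by
    rw [← zpow_natCast, ← zpow_add₀ hq0]; congr 1; ring
  have e2 : q ^ ((n : ℤ) + 1 - r') = q ^ ((n : ℤ) + 1 - r - r') * q ^ r := by
    rw [← zpow_natCast, ← zpow_add₀ hq0]; congr 1; ring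
  have h2 : (q ^ r' - q ^ r) * (q ^ ((n : ℤ) + 1 - r - r') - 1) = 0 := by
    rw [eigenVar, eigenVar, e1, e2] at h
    linear_combination h
  have h3 := (mul_eq_zero.1 h2).resolve_right (zpow_sub_one_ne_zero hq (by omega))
  exact (pow_right_injective₀ (by linarith) hq.ne' (sub_eq_zero.1 h3)).symm

theorem avoidEigenvalue_eq {q : ℝ} (hq : 1 < q) {n k r i : ℕ} (hkn : 2 * k ≤ n) (hrk : r ≤ k)
    (hik : i ≤ k) :
    avoidEigenvalue q n k (k - i) r = eigenFactor q n k r *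
      (q ^ (k * (k - i)) / (qFact q (n - 2 * k + i) * qFact q i) *
        ∏ l ∈ Finset.range i,
          (-(q ^ ((n : ℤ) - k + 1 + l) + q ^ ((k : ℤ) - l)) + 1 * eigenVar q n r)) := by
  have hq0 : q ≠ 0 := by linarith
  have hprod : ∏ l ∈ Finset.range i,
        (-(q ^ ((n : ℤ) - k + 1 + l) + q ^ ((k : ℤ) - l)) + 1 * eigenVar q n r) =
      q ^ (r * i) * (∏ l ∈ Finset.range i, (q ^ (n - k - r + 1 + l) - 1)) *
        ∏ l ∈ Finset.range i, (q ^ (((k - r : ℕ) : ℤ) - l) - 1) := by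
    rw [pow_mul, ← Finset.card_range i, ← Finset.prod_const, Finset.card_range,
      ← Finset.prod_mul_distrib, ← Finset.prod_mul_distrib]
    refine Finset.prod_congr rfl fun l _ => ?_
    have e1 : q ^ ((n : ℤ) - k + 1 + l) = q ^ r * q ^ (n - k - r + 1 + l) := by
      rw [← zpow_natCast, ← zpow_natCast, ← zpow_add₀ hq0]; congr 1; omega
    have e2 : q ^ ((k : ℤ) - l) = q ^ r * q ^ (((k - r : ℕ) : ℤ) - l) := by
      rw [← zpow_natCast, ← zpow_add₀ hq0]; congr 1; omega
    have e3 : q ^ ((n : ℤ) + 1 - r) =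
        q ^ r * q ^ (n - k - r + 1 + l) * q ^ (((k - r : ℕ) : ℤ) - l) := by
      rw [← zpow_natCast, ← zpow_natCast, ← zpow_add₀ hq0, ← zpow_add₀ hq0]; congr 1; omega
    rw [eigenVar, e1, e2, e3]
    ring
  rw [hprod, avoidEigenvalue, eigenFactor]
  -- For `i > k - r` both sides vanish, the right one through the factor `q^0 - 1`.
  rcases lt_or_ge (k - r) i with h | h
  · rw [qBinom_of_neg _ ((k : ℤ) - r) (by omega), Finset.prod_eq_zero (i := k - r) (f := fun l : ℕ =>
      q ^ (((k - r : ℕ) : ℤ) - l) - 1) (Finset.mem_range.2 h) (by simp)]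
    simp
  · have e1 : (n : ℤ) - r - ((k - i : ℕ) : ℤ) = ((n - k - r + i : ℕ) : ℤ) := by omega
    have e2 : (k : ℤ) - r = ((k - r : ℕ) : ℤ) := by omega
    have e3 : ((k - i : ℕ) : ℤ) - r = ((k - r - i : ℕ) : ℤ) := by omega
    have e4 : n - k - r + i - (k - r) = n - 2 * k + i := by omega
    have e5 : k - r - (k - r - i) = i := by omega
    rw [e1, e3, e2, qBinom_eq_qFact hq (by omega), qBinom_eq_qFact hq (by omega), e4, e5,
      qFact_add q (n - k - r) i]
    have e6 := qFact_eq_sub_mul q h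
    have e7 : q ^ r.choose 2 * q ^ (((k - i : ℕ) : ℤ) * ((k - r : ℕ) : ℤ)) =
        q ^ ((r.choose 2 : ℤ) - k * r) * q ^ (k * (k - i)) * q ^ (r * i) := by
      rw [← zpow_natCast q (r.choose 2), ← zpow_natCast q (k * (k - i)),
        ← zpow_natCast q (r * i), ← zpow_add₀ hq0, ← zpow_add₀ hq0, ← zpow_add₀ hq0]
      congr 1
      push_cast [Nat.cast_sub hrk, Nat.cast_sub hik]
      ring
    have n1 := (qFact_pos hq (k - r)).ne'
    have n2 := (qFact_pos hq (n - 2 * k + i)).ne'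
    have n3 := (qFact_pos hq i).ne'
    have n4 := (qFact_pos hq (k - r - i)).ne'
    generalize ∏ l ∈ Finset.range i, (q ^ (((k - r : ℕ) : ℤ) - l) - 1) = P at e6 ⊢
    generalize ∏ l ∈ Finset.range i, (q ^ (n - k - r + 1 + l) - 1) = P'
    rw [e6] at n1 ⊢
    have n5 := right_ne_zero_of_mul n1
    field_simp
    linear_combination qFact q (n - k - r) * P' * e7

/-- The `i`-th summand of the eigenvalue formula. -/
theorem qBinom_mul_qBinom_div_eq {q : ℝ} (hq : 1 < q) {n k r i : ℕ} (hkn : 2 * k ≤ n)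
    (hr : 1 ≤ r) (hrk : r ≤ k) (hik : i < k) :
    (-1 : ℝ) ^ r * q ^ ((r.choose 2 : ℤ) - k * r + k) *
        (1 / qBinom q ((n : ℤ) - k - 1) ((r : ℤ) - 1)) *
        (qBinom q ((k : ℤ) - i - 1) ((r : ℤ) - i - 1) * qBinom q ((n : ℤ) - r) i) =
      eigenFactor q n k r * (q ^ k * qFact q (k - i - 1) / (qFact q i * qFact q (n - k - 1)) *
        ∏ l ∈ Finset.range i,
          (q ^ ((n : ℤ) - 1 - 2 * l) + 1 + -q ^ (-1 - (l : ℤ)) * eigenVar q n r)) := by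
  have hq0 : q ≠ 0 := by linarith
  have hprod : ∏ l ∈ Finset.range i,
        (q ^ ((n : ℤ) - 1 - 2 * l) + 1 + -q ^ (-1 - (l : ℤ)) * eigenVar q n r) =
      (∏ l ∈ Finset.range i, (q ^ (((r - 1 : ℕ) : ℤ) - l) - 1)) *
        ∏ l ∈ Finset.range i, (q ^ (((n - r : ℕ) : ℤ) - l) - 1) := by
    rw [← Finset.prod_mul_distrib]
    refine Finset.prod_congr rfl fun l _ => ?_
    have e1 : q ^ ((n : ℤ) - 1 - 2 * l) =
        q ^ (((r - 1 : ℕ) : ℤ) - l) * q ^ (((n - r : ℕ) : ℤ) - l) := by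
      rw [← zpow_add₀ hq0]; congr 1; omega
    have e2 : q ^ (((r - 1 : ℕ) : ℤ) - l) = q ^ (-1 - (l : ℤ)) * q ^ r := by
      rw [← zpow_natCast, ← zpow_add₀ hq0]; congr 1; omega
    have e3 : q ^ (((n - r : ℕ) : ℤ) - l) = q ^ (-1 - (l : ℤ)) * q ^ ((n : ℤ) + 1 - r) := by
      rw [← zpow_add₀ hq0]; congr 1; omega
    rw [eigenVar, e1]
    linear_combination e2 + e3
  rw [hprod, eigenFactor]
  -- For `i > r - 1` both sides vanish, the right one through the factor `q^0 - 1`.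
  rcases lt_or_ge (r - 1) i with h | h
  · rw [qBinom_of_neg _ ((k : ℤ) - i - 1) (by omega), Finset.prod_eq_zero (i := r - 1)
      (f := fun l : ℕ => q ^ (((r - 1 : ℕ) : ℤ) - l) - 1) (Finset.mem_range.2 h) (by simp)]
    simp
  · have e1 : (n : ℤ) - k - 1 = ((n - k - 1 : ℕ) : ℤ) := by omega
    have e2 : (r : ℤ) - 1 = ((r - 1 : ℕ) : ℤ) := by omega
    have e3 : (k : ℤ) - i - 1 = ((k - i - 1 : ℕ) : ℤ) := by omega
    have e4 : (r : ℤ) - i - 1 = ((r - 1 - i : ℕ) : ℤ) := by omega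
    have e5 : (n : ℤ) - r = ((n - r : ℕ) : ℤ) := by omega
    have e6 : n - k - 1 - (r - 1) = n - k - r := by omega
    have e7 : k - i - 1 - (r - 1 - i) = k - r := by omega
    rw [e1, e2, e3, e4, e5, qBinom_eq_qFact hq (by omega), qBinom_eq_qFact hq (by omega),
      qBinom_eq_qFact hq (by omega), e6, e7, zpow_add₀ hq0, zpow_natCast,
      qFact_eq_sub_mul q h, qFact_eq_sub_mul q (show i ≤ n - r by omega)]
    have n1 := (qFact_pos hq (k - r)).ne'
    have n2 := (qFact_pos hq (n - k - 1)).ne'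
    have n3 := (qFact_pos hq i).ne'
    have n4 := (qFact_pos hq (r - 1 - i)).ne'
    have n5 := (qFact_pos hq (n - r - i)).ne'
    have n6 := (qFact_pos hq (n - k - r)).ne'
    field_simp

/-- The term added to `1` in the eigenvalue formula equals `-1` for `1 ≤ r ≤ t`, by the
`q`-Vandermonde identity. -/
theorem eigenvalue_formula_eq_neg_one {q : ℝ} (hq : 1 < q) {n k r t : ℕ} (hkn : 2 * k ≤ n)
    (hr : 1 ≤ r) (hrt : r ≤ t) (htk : t < k) :
    (-1 : ℝ) ^ r * q ^ ((r.choose 2 : ℤ) - k * r + k) *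
      (1 / qBinom q ((n : ℤ) - k - 1) ((r : ℤ) - 1)) *
      ∑ i ∈ Finset.range t, (-1 : ℝ) ^ i * q ^ (i.choose 2) *
        qBinom q ((k : ℤ) - i - 1) ((r : ℤ) - i - 1) * qBinom q ((n : ℤ) - r) i = -1 := by
  have hq0 : q ≠ 0 := by linarith
  obtain ⟨r, rfl⟩ := Nat.exists_eq_add_of_le' hr
  have h := sum_qBinom_mul_qBinom hq (n - (r + 1)) (k - 1) r
  have hsub : ∑ i ∈ Finset.range (r + 1), (-1 : ℝ) ^ i * q ^ (i.choose 2) *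
        qBinom q ((k : ℤ) - 1 - i) ((r : ℤ) - i) * qBinom q ((n - (r + 1) : ℕ) : ℤ) i =
      ∑ i ∈ Finset.range t, (-1 : ℝ) ^ i * q ^ (i.choose 2) *
        qBinom q ((k : ℤ) - i - 1) (((r + 1 : ℕ) : ℤ) - i - 1) *
          qBinom q ((n : ℤ) - ((r + 1 : ℕ) : ℤ)) i := by
    have : ∀ i : ℕ, (-1 : ℝ) ^ i * q ^ (i.choose 2) *
        qBinom q ((k : ℤ) - 1 - i) ((r : ℤ) - i) * qBinom q ((n - (r + 1) : ℕ) : ℤ) i =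
        (-1 : ℝ) ^ i * q ^ (i.choose 2) *
        qBinom q ((k : ℤ) - i - 1) (((r + 1 : ℕ) : ℤ) - i - 1) *
          qBinom q ((n : ℤ) - ((r + 1 : ℕ) : ℤ)) i := by
      intro i
      rw [show (k : ℤ) - 1 - i = (k : ℤ) - i - 1 by ring,
        show (r : ℤ) - i = ((r + 1 : ℕ) : ℤ) - i - 1 by push_cast; ring,
        show ((n - (r + 1) : ℕ) : ℤ) = (n : ℤ) - ((r + 1 : ℕ) : ℤ) by omega]
    rw [Finset.sum_congr rfl fun i _ => this i]
    refine Finset.sum_subset (Finset.range_subset_range.2 hrt) fun i _ hi => ?_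
    rw [Finset.mem_range, not_lt] at hi
    rw [qBinom_of_neg _ ((k : ℤ) - i - 1) (by omega), mul_zero, zero_mul]
  rw [← hsub, h]
  have e1 : ((n - (r + 1) : ℕ) : ℤ) - ((k : ℤ) - 1) + r - 1 = (n : ℤ) - k - 1 := by omega
  have e2 : ((r + 1 : ℕ) : ℤ) - 1 = r := by push_cast; ring
  have hne : qBinom q ((n : ℤ) - k - 1) r ≠ 0 := (qBinom_pos hq (by omega) (by omega)).ne'
  have e3 : q ^ (((r + 1).choose 2 : ℤ) - k * ((r + 1 : ℕ) : ℤ) + k) *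
      q ^ (((k : ℤ) - 1) * r - (r.choose 2 : ℕ)) = 1 := by
    rw [← zpow_add₀ hq0, Nat.choose_succ_succ' r 1, ← zpow_zero q]
    congr 1
    push_cast
    simp
    ring
  have e4 : (-1 : ℝ) ^ r * (-1) ^ r = 1 := by rw [← mul_pow]; simp
  rw [e1, e2, pow_succ]
  field_simp
  linear_combination (-(-1 : ℝ) ^ r * (-1) ^ r) * e3 - e4

theorem exists_polynomial_eval_eq_sum_prod (t : ℕ) (c : ℕ → ℝ) (u v : ℕ → ℝ) :
    ∃ p : Polynomial ℝ, p.degree < t ∧ ∀ x, p.eval x =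
      ∑ i ∈ Finset.range t, c i * ∏ l ∈ Finset.range i, (u l + v l * x) := by
  refine ⟨∑ i ∈ Finset.range t, Polynomial.C (c i) *
    ∏ l ∈ Finset.range i, (Polynomial.C (u l) + Polynomial.C (v l) * Polynomial.X), ?_, ?_⟩
  · rw [← Polynomial.mem_degreeLT]
    refine Submodule.sum_mem _ fun i hi => ?_
    rw [Polynomial.mem_degreeLT, ← Polynomial.smul_eq_C_mul]
    refine (Polynomial.degree_smul_le _ _).trans_lt ?_
    refine lt_of_le_of_lt ?_ (Nat.cast_lt.2 (Finset.mem_range.1 hi))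
    refine (Polynomial.degree_prod_le _ _).trans ?_
    refine (Finset.sum_le_card_nsmul _ _ 1 fun l _ => ?_).trans (by simp)
    rw [add_comm]
    exact Polynomial.degree_linear_le
  · intro x
    simp [Polynomial.eval_finsetSum, Polynomial.eval_prod]

/-- A combination of the eigenvalues of the `avoidMatrix F n k (k - i)`, `i < t`, that equals `-κ`
for `1 ≤ r ≤ t` is determined for all `r ≥ 1`: up to the nonzero factor `eigenFactor q n k r`, both
sides are polynomials of degree less than `t` in `eigenVar q n r`. -/
theorem add_sum_avoidEigenvalue_eq {q : ℝ} (hq : 1 < q) {n k t : ℕ} (hkn : 2 * k ≤ n)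
    (htk : t < k) (κ : ℝ) (a : ℕ → ℝ)
    (h0 : ∀ r, 1 ≤ r → r ≤ t →
      κ + ∑ i ∈ Finset.range t, a i * avoidEigenvalue q n k (k - i) r = 0)
    {r : ℕ} (hr : 1 ≤ r) (hrk : r ≤ k) :
    κ + ∑ i ∈ Finset.range t, a i * avoidEigenvalue q n k (k - i) r =
      κ * (1 + (-1 : ℝ) ^ r * q ^ ((r.choose 2 : ℤ) - k * r + k) *
        (1 / qBinom q ((n : ℤ) - k - 1) ((r : ℤ) - 1)) *
        ∑ i ∈ Finset.range t, (-1 : ℝ) ^ i * q ^ (i.choose 2) *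
          qBinom q ((k : ℤ) - i - 1) ((r : ℤ) - i - 1) * qBinom q ((n : ℤ) - r) i) := by
  obtain ⟨p, hpd, hp⟩ := exists_polynomial_eval_eq_sum_prod t
    (fun i => a i * (q ^ (k * (k - i)) / (qFact q (n - 2 * k + i) * qFact q i)))
    (fun l => -(q ^ ((n : ℤ) - k + 1 + l) + q ^ ((k : ℤ) - l))) (fun _ => 1)
  obtain ⟨p', hpd', hp'⟩ := exists_polynomial_eval_eq_sum_prod t
    (fun i => κ * ((-1 : ℝ) ^ i * q ^ (i.choose 2) *
      (q ^ k * qFact q (k - i - 1) / (qFact q i * qFact q (n - k - 1)))))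
    (fun l => q ^ ((n : ℤ) - 1 - 2 * l) + 1) (fun l => -q ^ (-1 - (l : ℤ)))
  have ev : ∀ r, r ≤ k → ∑ i ∈ Finset.range t, a i * avoidEigenvalue q n k (k - i) r =
      eigenFactor q n k r * p.eval (eigenVar q n r) := by
    intro r hrk
    rw [hp, Finset.mul_sum]
    refine Finset.sum_congr rfl fun i hi => ?_
    have hi := Finset.mem_range.1 hi
    rw [avoidEigenvalue_eq hq hkn hrk (by omega)]
    ring
  have ev' : ∀ r, 1 ≤ r → r ≤ k → κ * ((-1 : ℝ) ^ r * q ^ ((r.choose 2 : ℤ) - k * r + k) *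
        (1 / qBinom q ((n : ℤ) - k - 1) ((r : ℤ) - 1)) *
        ∑ i ∈ Finset.range t, (-1 : ℝ) ^ i * q ^ (i.choose 2) *
          qBinom q ((k : ℤ) - i - 1) ((r : ℤ) - i - 1) * qBinom q ((n : ℤ) - r) i) =
      eigenFactor q n k r * p'.eval (eigenVar q n r) := by
    intro r hr hrk
    rw [hp', Finset.mul_sum, Finset.mul_sum, Finset.mul_sum]
    refine Finset.sum_congr rfl fun i hi => ?_
    have hi := Finset.mem_range.1 hi
    have h := qBinom_mul_qBinom_div_eq hq hkn hr hrk (show i < k by omega)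
    linear_combination κ * ((-1 : ℝ) ^ i * q ^ (i.choose 2)) * h
  have hpp : p = p' := by
    refine Polynomial.eq_of_degrees_lt_of_eval_index_eq (Finset.Icc 1 t)
      (eigenVar_injOn hq (n := n) (by omega)) (by simpa using hpd) (by simpa using hpd') ?_
    intro r hr
    obtain ⟨hr1, hrt⟩ := Finset.mem_Icc.1 hr
    apply mul_left_cancel₀ (eigenFactor_ne_zero hq n k r)
    rw [← ev r (by omega), ← ev' r hr1 (by omega),
      eigenvalue_formula_eq_neg_one hq hkn hr1 hrt htk]
    linear_combination h0 r hr1 hrt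
  rw [mul_add, mul_one, ev' r hr hrk, ev r hrk, hpp]

theorem qNum_eq (q : ℝ) (m : ℤ) : qNum q m = (q ^ m - 1) / (q - 1) := by
  simp [qNum, qBinom]

/-- The number of blocks of a `q`-Steiner system as a sum. -/
theorem qBinom_div_qBinom_eq {q : ℝ} (hq : 1 < q) {n k : ℕ} (t : ℕ) (htk : t ≤ k) :
    qBinom q n t / qBinom q k t =
      1 - qNum q ((k : ℤ) - n) / qNum q k * ∑ i ∈ Finset.range t,
        q ^ ((n : ℤ) - i) * (qBinom q n i / qBinom q ((k : ℤ) - 1) i) := by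
  have hq0 : q ≠ 0 := by linarith
  have hq1 : q - 1 ≠ 0 := by linarith
  induction t with
  | zero => simp [qBinom_zero]
  | succ t ih =>
    rw [Finset.sum_range_succ, mul_add, ← sub_sub, ← ih (by omega)]
    have h1 := qBinom_succ_mul' hq n t
    have h2 := qBinom_succ_mul' hq k t
    have h3 := qBinom_succ_mul hq k t
    have n0 : q ^ ((t : ℤ) + 1) - 1 ≠ 0 := zpow_sub_one_ne_zero hq (by omega)
    have n1 : q ^ ((k : ℤ) - t) - 1 ≠ 0 := zpow_sub_one_ne_zero hq (by omega)
    have n2 : q ^ (k : ℤ) - 1 ≠ 0 := zpow_sub_one_ne_zero hq (by omega)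
    have n3 : qBinom q k t ≠ 0 := (qBinom_pos hq (by omega) (by omega)).ne'
    have n4 : qBinom q ((k : ℤ) - 1) t ≠ 0 := (qBinom_pos hq (by omega) (by omega)).ne'
    have a1 : qBinom q n (t + 1 : ℕ) =
        qBinom q n t * (q ^ ((n : ℤ) - t) - 1) / (q ^ ((t : ℤ) + 1) - 1) := by
      rw [eq_div_iff n0, h1]
    have a2 : qBinom q k (t + 1 : ℕ) =
        qBinom q k t * (q ^ ((k : ℤ) - t) - 1) / (q ^ ((t : ℤ) + 1) - 1) := by
      rw [eq_div_iff n0, h2]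
    have a3 : qBinom q ((k : ℤ) - 1) t =
        qBinom q k t * (q ^ ((k : ℤ) - t) - 1) / (q ^ (k : ℤ) - 1) := by
      rw [eq_div_iff n2, ← h2, h3, mul_comm]
    have a4 : q ^ ((k : ℤ) - n) * q ^ ((n : ℤ) - t) = q ^ ((k : ℤ) - t) := by
      rw [← zpow_add₀ hq0]; congr 1; ring
    rw [a1, a2, a3, qNum_eq, qNum_eq]
    field_simp
    linear_combination qBinom q n t * a4

end

/-! ### Spectrum of the Gram matrix -/

section

open Module

variable {F : Type*} [Field F] [Fintype F] {n k t r : ℕ}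

theorem gramMatrix_mulVec_of_mem {κ : ℝ} {a : ℕ → ℝ}
    (hgram : gramMatrix F t k n = κ • (1 : Matrix (Gr F n k) (Gr F n k) ℝ) +
      ∑ i ∈ Finset.range t, a i • avoidMatrix F n k (k - i))
    {f : Gr F n k → ℝ} (hf : f ∈ grassmannEigenspace F n k r) :
    (gramMatrix F t k n).mulVec f =
      (κ + ∑ i ∈ Finset.range t, a i * avoidEigenvalue (Fintype.card F) n k (k - i) r) • f := by
  rw [hgram, Matrix.add_mulVec, Matrix.sum_mulVec, Matrix.smul_mulVec, Matrix.one_mulVec,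
    add_smul, Finset.sum_smul]
  congr 1
  refine Finset.sum_congr rfl fun i _ => ?_
  rw [Matrix.smul_mulVec, avoidMatrix_mulVec_of_mem hf, smul_smul]

/-- The eigenvalues of a matrix acting by a scalar on each member of a spanning family of nonzero
subspaces are exactly these scalars. -/
theorem hasEigenvalue_toLin'_iff {ι m : Type*} [Fintype m] [DecidableEq m] (A : Matrix m m ℝ)
    (W : ι → Submodule ℝ (m → ℝ)) (μ : ι → ℝ) (htop : ⨆ i, W i = ⊤) (hbot : ∀ i, W i ≠ ⊥)
    (hμ : ∀ i, ∀ f ∈ W i, A.mulVec f = μ i • f) (x : ℝ) :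
    Module.End.HasEigenvalue (Matrix.toLin' A) x ↔ ∃ i, x = μ i := by
  constructor
  · intro hx
    by_contra! hne
    obtain ⟨f, hf⟩ := hx.exists_hasEigenvector
    -- If `x` is none of the scalars, `A - x` is surjective, hence injective.
    have hsurj : LinearMap.range (Matrix.toLin' A - x • LinearMap.id) = ⊤ := by
      rw [eq_top_iff, ← htop]
      refine iSup_le fun i g hg => ⟨(μ i - x)⁻¹ • g, ?_⟩
      have h0 : μ i - x ≠ 0 := sub_ne_zero.2 (hne i).symm
      rw [map_smul, LinearMap.sub_apply, Matrix.toLin'_apply, hμ i g hg, LinearMap.smul_apply,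
        LinearMap.id_apply, ← sub_smul, smul_smul, inv_mul_cancel₀ h0, one_smul]
    have hinj := LinearMap.ker_eq_bot_iff_range_eq_top.2 hsurj
    refine hf.2 ((Submodule.mem_bot ℝ).1 (hinj ▸ LinearMap.mem_ker.2 ?_))
    rw [LinearMap.sub_apply, hf.apply_eq_smul, LinearMap.smul_apply, LinearMap.id_apply, sub_self]
  · rintro ⟨i, rfl⟩
    obtain ⟨f, hf, hf0⟩ := Submodule.exists_mem_ne_zero_of_ne_bot (hbot i)
    refine Module.End.hasEigenvalue_of_hasEigenvector (x := f)
      ⟨Module.End.mem_eigenspace_iff.2 ?_, hf0⟩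
    rw [Matrix.toLin'_apply, hμ i f hf]

end

theorem mainTheorem2 {F : Type*} [Field F] [Fintype F] (q t k n : ℕ)
    (hq : Fintype.card F = q) (ht : 1 ≤ t) (htk : t < k) (hkn : 2 * k ≤ n) :
    ∃ μ : ℕ → ℝ,
      (∀ X : Gr F n k,
        μ 0 = (blockCount F t k n X : ℝ) *
          (1 - qNum q ((k : ℤ) - n) / qNum q k *
            ∑ i ∈ Finset.range t,
              (q : ℝ) ^ ((n : ℤ) - i) * (qBinom q n i / qBinom q ((k : ℤ) - 1) i)) ∧
        ∀ r : ℕ, 1 ≤ r → r ≤ k →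
          μ r = (blockCount F t k n X : ℝ) *
            (1 + (-1 : ℝ) ^ r * (q : ℝ) ^ ((r.choose 2 : ℤ) - k * r + k) *
              (1 / qBinom q ((n : ℤ) - k - 1) ((r : ℤ) - 1)) *
              ∑ i ∈ Finset.range t,
                (-1 : ℝ) ^ i * (q : ℝ) ^ (i.choose 2) *
                  qBinom q ((k : ℤ) - i - 1) ((r : ℤ) - i - 1) *
                  qBinom q ((n : ℤ) - r) i)) ∧
      (∀ x : ℝ, Module.End.HasEigenvalue (Matrix.toLin' (gramMatrix F t k n)) x ↔
        ∃ r : ℕ, r ≤ k ∧ x = μ r) ∧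
      DirectSum.IsInternal (fun r : Fin (k + 1) => grassmannEigenspace F n k r) ∧
      (∀ r : ℕ, r ≤ k → grassmannEigenspace F n k r ≠ ⊥ ∧
        ∀ f ∈ grassmannEigenspace F n k r, (gramMatrix F t k n).mulVec f = μ r • f) := by
  subst hq
  have hq := one_lt_card_real F
  obtain ⟨κ, a, hκ, hgram⟩ := exists_gramMatrix_eq_sum_avoidMatrix F n htk
  set ν : ℕ → ℝ := fun r =>
    κ + ∑ i ∈ Finset.range t, a i * avoidEigenvalue (Fintype.card F) n k (k - i) r with hν
  have hact : ∀ r, ∀ f ∈ grassmannEigenspace F n k r,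
      (gramMatrix F t k n).mulVec f = ν r • f :=
    fun r f hf => gramMatrix_mulVec_of_mem hgram hf
  have hbot : ∀ r ≤ k, grassmannEigenspace F n k r ≠ ⊥ :=
    fun r hr => grassmannEigenspace_ne_bot hkn hr
  have hvan : ∀ r, 1 ≤ r → r ≤ t → ν r = 0 := by
    intro r hr hrt
    obtain ⟨f, hf, hf0⟩ := Submodule.exists_mem_ne_zero_of_ne_bot (hbot r (by omega))
    have h := hact r f hf
    rw [gramMatrix_mulVec_eq_zero hr hrt htk.le hf] at h
    exact (smul_eq_zero.1 h.symm).resolve_right hf0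
  have hzero : ν 0 = κ * (qBinom (Fintype.card F) n t / qBinom (Fintype.card F) k t) := by
    obtain ⟨f, hf, hf0⟩ := Submodule.exists_mem_ne_zero_of_ne_bot (hbot 0 (Nat.zero_le k))
    obtain ⟨X, hX⟩ := Function.ne_iff.1 hf0
    have h := congrFun (hact 0 f hf) X
    rw [gramMatrix_mulVec_zero htk.le hf, gramMatrix_self, hκ, Pi.smul_apply, smul_eq_mul] at h
    exact (mul_right_cancel₀ hX h).symm
  refine ⟨ν, fun X => ⟨?_, fun r hr hrk => ?_⟩, fun x => ?_,
    isInternal_grassmannEigenspace hkn, fun r hr => ⟨hbot r hr, hact r⟩⟩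
  · rw [hzero, hκ, qBinom_div_qBinom_eq hq t htk.le]
  · rw [hκ]
    exact add_sum_avoidEigenvalue_eq hq hkn htk κ a hvan hr hrk
  · rw [hasEigenvalue_toLin'_iff (gramMatrix F t k n)
      (fun r : Fin (k + 1) => grassmannEigenspace F n k r) (fun r => ν r)
      iSup_grassmannEigenspace (fun r => hbot r (by omega)) (fun r => hact r)]
    constructor
    · rintro ⟨r, rfl⟩
      exact ⟨r, by omega, rfl⟩
    · rintro ⟨r, hr, rfl⟩
      exact ⟨⟨r, by omega⟩, rfl⟩
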